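/- Let $\zeta=\frac{1+\sqrt{3}\,i}{2}$, $e(x)=\exp(2\pi i x)$, $L_\zeta=\mathbb{Z}\zeta+\mathbb{Z}$ and $E_\zeta=\mathbb{C}/L_\zeta$. Let $C_\zeta$ be the non-singular projective model of the plane curve $u^6=t^3(t-1)$, realised as the smooth plane cubic $W^2Z=X^3+Z^3$ with $t=\frac{W^2}{W^2-Z^2}$ and $u=\frac{WX}{W^2-Z^2}$; let $P_1\in C_\zeta$ be the point $(t,u)=(1,0)$, and let $P_{\infty,1},P_{\infty,2}$ be the two points of $C_\zeta$ over $t=\infty$. Let $\psi=\frac{u\,dt}{t(t-1)}$, a holomorphic $1$-form on $C_\zeta$, and $$\psi_1=\frac{1}{(1-\zeta^2)\,B(\frac13,\frac16)}\,\psi ,$$ where $B$ is the beta function. Then the Abel-Jacobi map $$\jmath_\zeta:C_\zeta\to E_\zeta,\qquad P\mapsto\int_{P_1}^{P}\psi_1 \bmod L_\zeta$$ is well defined (every point is joined to $P_1$ by a continuously differentiable path, and the class of the integral modulo $L_\zeta$ does not depend on the path) and bijective, and multiplication by $1+\zeta$ on $E_\zeta$ is given by the following formula: if $z=\jmath_\zeta(P)$,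 where $P\in C_\zeta$ has coordinates $(t,u)$, then $$\jmath_\zeta^{-1}\big((1+\zeta)z\big)=\left(\frac{t(9-8t)^2}{(4t-3)^3},\ e\big(\tfrac1{12}\big)\sqrt3\,u\,\frac{9-8t}{(4t-3)^2}\right).$$ Here the formula is an identity between maps $C_\zeta\to C_\zeta$: the map $P\mapsto Q=\jmath_\zeta^{-1}((1+\zeta)\jmath_\zeta(P))$ is continuous; if $P$ does not lie over $t=\infty$ and $t\neq\frac34$, then $Q$ does not lie over $t=\infty$ and its coordinates are given by the formula; if $t=\frac34$, then $Q\in\{P_{\infty,1},P_{\infty,2}\}$; and if $P\in\{P_{\infty,1},P_{\infty,2}\}$, then $Q=P_1$. -/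

import Mathlib

open scoped LinearAlgebra.Projectivization

namespace ZetaCurve

noncomputable section

/-- `ζ = (1 + √3 i) / 2`, a primitive sixth root of unity. -/
def zeta : ℂ := (1 + (Real.sqrt 3 : ℂ) * Complex.I) / 2

/-- `e(x) = exp(2π i x)`. -/
def ex (x : ℂ) : ℂ := Complex.exp (2 * Real.pi * Complex.I * x)

theorem zeta_sq : zeta ^ 2 = zeta - 1 := by
  have h3 : (Real.sqrt 3 : ℂ) ^ 2 = 3 := by
    rw [← Complex.ofReal_pow, Real.sq_sqrt (by norm_num)]; norm_num
  unfold zeta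
  linear_combination (1 / 4 : ℂ) * Complex.I ^ 2 * h3 + (3 / 4 : ℂ) * Complex.I_sq

/-! ### The complex torus `E_ζ = ℂ / L_ζ` -/

/-- The lattice `L_ζ = ℤ ζ + ℤ`. -/
def latticeL : AddSubgroup ℂ := AddSubgroup.closure {zeta, 1}

/-- The complex torus `E_ζ = ℂ / L_ζ`. -/
abbrev torusE : Type := ℂ ⧸ latticeL

theorem oneAddZeta_mul_mem {x : ℂ} (hx : x ∈ latticeL) : (1 + zeta) * x ∈ latticeL := by
  have h1 : (1 : ℂ) ∈ latticeL := AddSubgroup.subset_closure (by simp)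
  have hz : zeta ∈ latticeL := AddSubgroup.subset_closure (by simp)
  refine AddSubgroup.closure_induction (p := fun y _ => (1 + zeta) * y ∈ latticeL)
    ?_ ?_ ?_ ?_ hx
  · intro y hy
    rcases hy with rfl | hy
    · have e : (1 + zeta) * zeta = zeta + zeta - 1 := by linear_combination zeta_sq
      rw [e]
      exact latticeL.sub_mem (latticeL.add_mem hz hz) h1
    · rw [Set.mem_singleton_iff.mp hy, mul_one]
      exact latticeL.add_mem h1 hz
  · simp
  · intro a b _ _ ha hb
    rw [mul_add]; exact latticeL.add_mem ha hb
  · intro a _ ha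
    rw [mul_neg]; exact latticeL.neg_mem ha

/-- Multiplication by `1 + ζ` on `E_ζ`. -/
def mulOneAddZeta : torusE →+ torusE :=
  QuotientAddGroup.map latticeL latticeL (AddMonoidHom.mulLeft (1 + zeta))
    (fun _ hx => oneAddZeta_mul_mem hx)

/-! ### The curve `C_ζ : u⁶ = t³ (t - 1)`

The non-singular model is realised as the smooth plane cubic `W² Z = X³ + Z³`.
The meromorphic functions `t`, `u` on it are given by
`[1 : t : u] = [W² - Z² : W² : W X]`, with inverse `X / Z = t / u²`, `W / Z = t² / u³`. -/

/-- The affine plane curve `u⁶ = t³ (t - 1)`. -/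
def OnAffineCurve (t u : ℂ) : Prop := u ^ 6 = t ^ 3 * (t - 1)

/-- The homogeneous equation `W² Z = X³ + Z³` for `p = (X, W, Z)`. -/
def OnCubic (p : Fin 3 → ℂ) : Prop := p 1 ^ 2 * p 2 = p 0 ^ 3 + p 2 ^ 3

/-- The partial derivatives of `F = W² Z - X³ - Z³` with respect to `X`, `W`, `Z`. -/
def gradF (p : Fin 3 → ℂ) : Fin 3 → ℂ :=
  ![-3 * p 0 ^ 2, 2 * p 1 * p 2, p 1 ^ 2 - 3 * p 2 ^ 2]

/-- The cubic is non-singular. -/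
theorem gradF_ne_zero {p : Fin 3 → ℂ} (hp : p ≠ 0) : gradF p ≠ 0 := by
  intro h
  have h0 : -3 * p 0 ^ 2 = 0 := by simpa [gradF] using congrFun h 0
  have h1 : 2 * p 1 * p 2 = 0 := by simpa [gradF] using congrFun h 1
  have h2 : p 1 ^ 2 - 3 * p 2 ^ 2 = 0 := by simpa [gradF] using congrFun h 2
  have a0 : p 0 = 0 := by simpa using h0
  have a12 : p 1 = 0 ∧ p 2 = 0 := by
    rcases mul_eq_zero.mp h1 with h | h
    · have : p 1 = 0 := by simpa using h
      rw [this] at h2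
      exact ⟨this, by simpa using h2⟩
    · rw [h] at h2
      exact ⟨by simpa using h2, h⟩
  apply hp
  ext i
  fin_cases i
  · exact a0
  · exact a12.1
  · exact a12.2

/-- The quotient topology on the complex projective plane. -/
instance projTopology : TopologicalSpace (ℙ ℂ (Fin 3 → ℂ)) :=
  TopologicalSpace.coinduced (Projectivization.mk' ℂ) inferInstance

/-- The non-singular model of `C_ζ`, with its topology as a subspace of the projective plane. -/
abbrev CurveC : Type := {P : ℙ ℂ (Fin 3 → ℂ) // OnCubic P.rep}

theorem OnCubic.smul {p : Fin 3 → ℂ} (h : OnCubic p) (a : ℂ) : OnCubic (a • p) := by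
  simp only [OnCubic, Pi.smul_apply, smul_eq_mul] at *
  linear_combination a ^ 3 * h

theorem onCubic_rep_mk {p : Fin 3 → ℂ} (hp : p ≠ 0) (h : OnCubic p) :
    OnCubic (Projectivization.mk ℂ p hp).rep := by
  obtain ⟨a, ha⟩ := Projectivization.exists_smul_eq_mk_rep ℂ p hp
  rw [← ha]
  exact h.smul (a : ℂ)

/-- The point of `C_ζ` with homogeneous coordinates `p`. -/
def point (p : Fin 3 → ℂ) (hp : p ≠ 0) (h : OnCubic p) : CurveC :=
  ⟨Projectivization.mk ℂ p hp, onCubic_rep_mk hp h⟩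

/-- The function `t` in homogeneous coordinates. -/
def tFun (p : Fin 3 → ℂ) : ℂ := p 1 ^ 2 / (p 1 ^ 2 - p 2 ^ 2)

/-- The function `u` in homogeneous coordinates. -/
def uFun (p : Fin 3 → ℂ) : ℂ := p 1 * p 0 / (p 1 ^ 2 - p 2 ^ 2)

/-- `P` does not lie over `t = ∞`; the points that are not finite are `P_{∞,1}` and `P_{∞,2}`. -/
def IsFinite (P : CurveC) : Prop := P.1.rep 1 ^ 2 - P.1.rep 2 ^ 2 ≠ 0

/-- The coordinate `t` at a finite point. -/
def tCoord (P : CurveC) : ℂ := tFun P.1.rep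

/-- The coordinate `u` at a finite point. -/
def uCoord (P : CurveC) : ℂ := uFun P.1.rep

theorem tFun_smul (a : ℂ) (ha : a ≠ 0) (p : Fin 3 → ℂ) : tFun (a • p) = tFun p := by
  simp only [tFun, Pi.smul_apply, smul_eq_mul]
  rw [show (a * p 1) ^ 2 = a ^ 2 * p 1 ^ 2 by ring,
    show a ^ 2 * p 1 ^ 2 - (a * p 2) ^ 2 = a ^ 2 * (p 1 ^ 2 - p 2 ^ 2) by ring,
    mul_div_mul_left _ _ (pow_ne_zero 2 ha)]

theorem uFun_smul (a : ℂ) (ha : a ≠ 0) (p : Fin 3 → ℂ) : uFun (a • p) = uFun p := by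
  simp only [uFun, Pi.smul_apply, smul_eq_mul]
  rw [show a * p 1 * (a * p 0) = a ^ 2 * (p 1 * p 0) by ring,
    show (a * p 1) ^ 2 - (a * p 2) ^ 2 = a ^ 2 * (p 1 ^ 2 - p 2 ^ 2) by ring,
    mul_div_mul_left _ _ (pow_ne_zero 2 ha)]

theorem tCoord_point (p : Fin 3 → ℂ) (hp : p ≠ 0) (h : OnCubic p) :
    tCoord (point p hp h) = tFun p := by
  obtain ⟨a, ha⟩ := Projectivization.exists_smul_eq_mk_rep ℂ p hp
  simp only [tCoord, point]
  rw [← ha]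
  exact tFun_smul a a.ne_zero p

theorem uCoord_point (p : Fin 3 → ℂ) (hp : p ≠ 0) (h : OnCubic p) :
    uCoord (point p hp h) = uFun p := by
  obtain ⟨a, ha⟩ := Projectivization.exists_smul_eq_mk_rep ℂ p hp
  simp only [uCoord, point]
  rw [← ha]
  exact uFun_smul a a.ne_zero p

theorem isFinite_point (p : Fin 3 → ℂ) (hp : p ≠ 0) (h : OnCubic p) :
    IsFinite (point p hp h) ↔ p 1 ^ 2 - p 2 ^ 2 ≠ 0 := by
  obtain ⟨a, ha⟩ := Projectivization.exists_smul_eq_mk_rep ℂ p hp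
  simp only [IsFinite, point]
  rw [← ha]
  change ((a : ℂ) * p 1) ^ 2 - ((a : ℂ) * p 2) ^ 2 ≠ 0 ↔ _
  rw [show ((a : ℂ) * p 1) ^ 2 - ((a : ℂ) * p 2) ^ 2
    = (a : ℂ) ^ 2 * (p 1 ^ 2 - p 2 ^ 2) by ring]
  simp [a.ne_zero]

/-- The finite points map to the affine curve. -/
theorem onAffineCurve_coord (P : CurveC) (hP : IsFinite P) :
    OnAffineCurve (tCoord P) (uCoord P) := by
  have h : OnCubic P.1.rep := P.2
  unfold IsFinite at hP
  simp only [OnAffineCurve, OnCubic, tCoord, uCoord, tFun, uFun] at *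
  set x := P.1.rep 0
  set w := P.1.rep 1
  set z := P.1.rep 2
  have hx : x ^ 3 = z * (w ^ 2 - z ^ 2) := by linear_combination -h
  have e : (w * x) ^ 6 = w ^ 6 * z ^ 2 * (w ^ 2 - z ^ 2) ^ 2 := by
    rw [mul_pow, show x ^ 6 = (x ^ 3) ^ 2 by ring, hx]; ring
  rw [div_pow, e]
  field_simp
  ring

/-- Away from its singular point `(0, 0)` the affine curve is identified with its preimage in the
non-singular model by the coordinates `(t, u)`. -/
theorem existsUnique_point {t u : ℂ} (h : OnAffineCurve t u) (h0 : t ≠ 0) :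
    ∃! P : CurveC, IsFinite P ∧ tCoord P = t ∧ uCoord P = u := by
  unfold OnAffineCurve at h
  -- the preimage is `[u t : t² : u³]`
  set p : Fin 3 → ℂ := ![u * t, t ^ 2, u ^ 3] with hpdef
  have hp : p ≠ 0 := fun e => h0 (by simpa [hpdef] using congrFun e 1)
  have p0 : p 0 = u * t := rfl
  have p1 : p 1 = t ^ 2 := rfl
  have p2 : p 2 = u ^ 3 := rfl
  have hc : OnCubic p := by
    simp only [OnCubic, p0, p1, p2]; linear_combination -u ^ 3 * h
  have hd : p 1 ^ 2 - p 2 ^ 2 = t ^ 3 := by rw [p1, p2]; linear_combination -h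
  have ht3 : t ^ 3 ≠ 0 := pow_ne_zero 3 h0
  refine ⟨point p hp hc, ⟨?_, ?_, ?_⟩, ?_⟩
  · rw [isFinite_point, hd]; exact ht3
  · rw [tCoord_point, tFun, hd, p1]; field_simp
  · rw [uCoord_point, uFun, hd, p1, p0]; field_simp
  · rintro Q ⟨hQ, hQt, hQu⟩
    have hQc : OnCubic Q.1.rep := Q.2
    apply Subtype.ext
    rw [← Projectivization.mk_rep Q.1]
    change _ = Projectivization.mk ℂ p hp
    rw [Projectivization.mk_eq_mk_iff']
    simp only [IsFinite, tCoord, uCoord, tFun, uFun, OnCubic] at hQ hQt hQu hQc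
    set x := Q.1.rep 0
    set w := Q.1.rep 1
    set z := Q.1.rep 2
    have e1 : w ^ 2 = t * (w ^ 2 - z ^ 2) := (div_eq_iff hQ).mp hQt
    have e2 : w * x = u * (w ^ 2 - z ^ 2) := (div_eq_iff hQ).mp hQu
    have hx : x ^ 3 = z * (w ^ 2 - z ^ 2) := by linear_combination -hQc
    have hw : w ≠ 0 := by
      intro hw
      rw [hw] at e1 hQ
      exact (mul_ne_zero h0 hQ) (by linear_combination -e1)
    have ht : t = w ^ 2 / (w ^ 2 - z ^ 2) := hQt.symm
    have hu : u = w * x / (w ^ 2 - z ^ 2) := hQu.symm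
    refine ⟨(w ^ 2 - z ^ 2) ^ 2 / w ^ 3, ?_⟩
    ext i
    fin_cases i
    · change (w ^ 2 - z ^ 2) ^ 2 / w ^ 3 * (u * t) = x
      rw [ht, hu]; field_simp
    · change (w ^ 2 - z ^ 2) ^ 2 / w ^ 3 * t ^ 2 = w
      rw [ht]; field_simp
    · change (w ^ 2 - z ^ 2) ^ 2 / w ^ 3 * u ^ 3 = z
      rw [hu, div_pow, mul_pow, hx]; field_simp

theorem onCubic_inf : OnCubic ![0, 1, 0] := by simp [OnCubic]

theorem vec_inf_ne_zero : (![0, 1, 0] : Fin 3 → ℂ) ≠ 0 := fun h => one_ne_zero (congrFun h 1)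

/-- The point `P₁ = (1, 0)`. -/
def P1 : CurveC := point ![0, 1, 0] vec_inf_ne_zero onCubic_inf

theorem P1_coord : IsFinite P1 ∧ tCoord P1 = 1 ∧ uCoord P1 = 0 := by
  refine ⟨?_, ?_, ?_⟩
  · rw [P1, isFinite_point]; simp
  · rw [P1, tCoord_point]; simp [tFun]
  · rw [P1, uCoord_point]; simp [uFun]

/-! ### The holomorphic 1-form `ψ = u dt / (t (t - 1))` -/

/-- The value of the holomorphic 1-form `ψ` at the point with homogeneous coordinates
`p = (X, W, Z)` on the tangent vector `v`, in the three expressions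
`ψ = -6 (Z dX - X dZ) / F_W = -6 (W dZ - Z dW) / F_X = -6 (X dW - W dX) / F_Z`, which agree
wherever the denominators do not vanish; at least one denominator is non-zero. -/
def psi (p v : Fin 3 → ℂ) : ℂ :=
  if gradF p 1 ≠ 0 then -6 * (p 2 * v 0 - p 0 * v 2) / gradF p 1
  else if gradF p 0 ≠ 0 then -6 * (p 1 * v 2 - p 2 * v 1) / gradF p 0
  else -6 * (p 0 * v 1 - p 1 * v 0) / gradF p 2

/-- `v` is tangent at `p` to the cone over the cubic. -/
def IsTangent (p v : Fin 3 → ℂ) : Prop :=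
  gradF p 0 * v 0 + gradF p 1 * v 1 + gradF p 2 * v 2 = 0

theorem isTangent_of_hasDerivAt {c : ℝ → Fin 3 → ℂ} {v : Fin 3 → ℂ} {s : ℝ}
    (hc : HasDerivAt c v s) (h : ∀ᶠ r in nhds s, OnCubic (c r)) : IsTangent (c s) v := by
  have h0 := hasDerivAt_pi.mp hc 0
  have h1 := hasDerivAt_pi.mp hc 1
  have h2 := hasDerivAt_pi.mp hc 2
  have hF := (((h1.pow 2).mul h2).sub (h0.pow 3)).sub (h2.pow 3)
  have hz : (fun r => c r 1 ^ 2 * c r 2 - c r 0 ^ 3 - c r 2 ^ 3) =ᶠ[nhds s] fun _ => 0 := by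
    filter_upwards [h] with r hr
    unfold OnCubic at hr
    linear_combination hr
  have := hF.unique ((hasDerivAt_const s (0 : ℂ)).congr_of_eventuallyEq hz)
  simp only [IsTangent, gradF]
  simp at this ⊢
  linear_combination this

/-- All three expressions for `ψ` hold simultaneously. -/
theorem psi_mul_gradF {p v : Fin 3 → ℂ} (hp : p ≠ 0) (h : OnCubic p) (hv : IsTangent p v) :
    psi p v * gradF p 0 = -6 * (p 1 * v 2 - p 2 * v 1) ∧
    psi p v * gradF p 1 = -6 * (p 2 * v 0 - p 0 * v 2) ∧
    psi p v * gradF p 2 = -6 * (p 0 * v 1 - p 1 * v 0) := by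
  have hE : gradF p 0 * p 0 + gradF p 1 * p 1 + gradF p 2 * p 2 = 0 := by
    simp only [OnCubic] at h
    simp [gradF]
    linear_combination 3 * h
  have hg := gradF_ne_zero hp
  unfold IsTangent at hv
  unfold psi
  set a := gradF p 0
  set b := gradF p 1
  set d := gradF p 2
  by_cases hb : b ≠ 0
  · rw [if_pos hb]
    refine ⟨?_, ?_, ?_⟩
    · field_simp
      linear_combination v 2 * hE - p 2 * hv
    · field_simp
    · field_simp
      linear_combination p 0 * hv - v 0 * hE
  · rw [if_neg hb]
    have hb0 : b = 0 := not_not.mp hb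
    rw [hb0] at hE hv ⊢
    by_cases ha : a ≠ 0
    · rw [if_pos ha]
      refine ⟨?_, ?_, ?_⟩
      · field_simp
      · have : a * (p 2 * v 0 - p 0 * v 2) = 0 := by
          linear_combination p 2 * hv - v 2 * hE
        rcases mul_eq_zero.mp this with h | h
        · exact absurd h ha
        · rw [h]; simp
      · field_simp
        linear_combination v 1 * hE - p 1 * hv
    · rw [if_neg ha]
      have ha0 : a = 0 := not_not.mp ha
      rw [ha0] at hE hv ⊢
      have hd : d ≠ 0 := by
        intro hd
        apply hg
        ext i
        fin_cases i
        · exact ha0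
        · exact hb0
        · exact hd
      have hp2 : p 2 = 0 := by simpa [hd] using hE
      have hv2 : v 2 = 0 := by simpa [hd] using hv
      refine ⟨?_, ?_, ?_⟩
      · rw [hp2, hv2]; simp
      · rw [hp2, hv2]; simp
      · field_simp

/-- Away from `t = 0, 1, ∞` the form `ψ` is `u dt / (t (t - 1))`. -/
theorem psi_eq {c : ℝ → Fin 3 → ℂ} {v : Fin 3 → ℂ} {s : ℝ} (hc : HasDerivAt c v s)
    (h : ∀ᶠ r in nhds s, OnCubic (c r)) (h0 : c s 0 ≠ 0) (h1 : c s 1 ≠ 0) (h2 : c s 2 ≠ 0) :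
    psi (c s) v =
      uFun (c s) * deriv (fun r => tFun (c r)) s / (tFun (c s) * (tFun (c s) - 1)) := by
  have hcs : OnCubic (c s) := h.self_of_nhds
  have hv := isTangent_of_hasDerivAt hc h
  have hps := (psi_mul_gradF (fun e => h0 (congrFun e 0)) hcs hv).1
  have d1 := hasDerivAt_pi.mp hc 1
  have d2 := hasDerivAt_pi.mp hc 2
  unfold OnCubic at hcs
  have hne : c s 1 ^ 2 - c s 2 ^ 2 ≠ 0 := by
    intro e
    apply pow_ne_zero 3 h0
    linear_combination c s 2 * e - hcs
  have ht := (d1.pow 2).div ((d1.pow 2).sub (d2.pow 2)) hne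
  have hd : deriv (fun r => tFun (c r)) s =
      2 * c s 1 * c s 2 * (c s 1 * v 2 - c s 2 * v 1) / (c s 1 ^ 2 - c s 2 ^ 2) ^ 2 := by
    refine (ht.deriv).trans ?_
    simp
    ring
  have ht1 : tFun (c s) - 1 = c s 2 ^ 2 / (c s 1 ^ 2 - c s 2 ^ 2) := by
    unfold tFun; field_simp; ring
  rw [hd, ht1]
  have hg : gradF (c s) 0 = -3 * c s 0 ^ 2 := rfl
  rw [hg] at hps
  have hx : c s 0 ^ 3 = c s 2 * (c s 1 ^ 2 - c s 2 ^ 2) := by linear_combination -hcs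
  have key : psi (c s) v * c s 0 ^ 2 = 2 * (c s 1 * v 2 - c s 2 * v 1) := by
    linear_combination (-1 / 3 : ℂ) * hps
  have key2 : psi (c s) v = 2 * (c s 1 * v 2 - c s 2 * v 1) / c s 0 ^ 2 := by
    rw [eq_div_iff (pow_ne_zero 2 h0)]; exact key
  rw [key2]
  unfold tFun uFun
  field_simp
  linear_combination -(c s 1 * v 2 - c s 2 * v 1) * hx

/-! ### The Abel-Jacobi map -/

/-- `c` gives, in homogeneous coordinates, a continuously differentiable path on the curve
from `P` to `Q`, parametrised by `[0, 1]`. -/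
def IsPath (c : ℝ → Fin 3 → ℂ) (P Q : CurveC) : Prop :=
  ContDiffOn ℝ 1 c (Set.Icc 0 1) ∧
  (∀ s ∈ Set.Icc (0 : ℝ) 1, c s ≠ 0 ∧ OnCubic (c s)) ∧
  (∃ h : c 0 ≠ 0, Projectivization.mk ℂ (c 0) h = P.1) ∧
  (∃ h : c 1 ≠ 0, Projectivization.mk ℂ (c 1) h = Q.1)

/-- The integral of the normalised form `ψ₁ = ψ / ((1 - ζ²) B(1/3, 1/6))` along a path. -/
def integralPsi1 (c : ℝ → Fin 3 → ℂ) : ℂ :=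
  (∫ s in (0 : ℝ)..1, psi (c s) (derivWithin c (Set.Icc 0 1) s)) /
    ((1 - zeta ^ 2) * Complex.betaIntegral (1 / 3) (1 / 6))

open Classical in
/-- The Abel-Jacobi map `P ↦ ∫_{P₁}^P ψ₁ ∈ E_ζ`, computed along some path from `P₁` to `P`. -/
def abelJacobi (P : CurveC) : torusE :=
  if h : ∃ c, IsPath c P1 P then (integralPsi1 h.choose : torusE) else 0

end

end ZetaCurve

namespace ZetaCurve

noncomputable section

/-! In the coordinates x = X/Z, w = W/Z the curve is w² = x³ + 1 and ψ = -3 dx/w. Since the lattice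
is stable under multiplication by ζ, its invariant g₂ vanishes, so ℘'² = 4℘³ - g₃. Let K = (1 - ζ²)
B(1/3, 1/6). The functions x = 36 ℘/K² and w = -108 ℘'/K³ satisfy the cubic precisely when K⁶ =
-11664 g₃, and then ψ pulls back to K dz, so ψ₁ pulls back to dz. The identity for K
(`psiConst_pow_six`) is the transcendental input: it says that the beta function computes the real
period, so that the period lattice of ψ₁ is L_ζ itself. The relation `Rep z p` says that p is a
homogeneous vector over the image of z. It is onto (`exists_rep`), and z is determined modulo the
lattice (`Rep.sub_mem`). A path from P₁ and the uniformised primitive of ψ₁ along it solve the same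
differential equation, so the endpoint of the path is represented by its integral
(`rep_integralPsi1`). Hence the Abel-Jacobi map inverts the uniformisation: it does not depend on
the path and is bijective, with no appeal to homology. For the formula, the cubic map `phi` sends
the curve to itself, fixes P₁ and satisfies phi*ψ = (1 + ζ) ψ (`psi_phi`). Applying it to a path
from P₁ multiplies the integral by 1 + ζ, so it is multiplication by 1 + ζ on the torus. Rewriting
`phi` in t and u gives the stated expressions. -/

/-! ### The isogeny of degree 3 on the cubic, and its expression in t and u. -/

theorem zeta_ne_zero : zeta ≠ 0 := by
  intro h
  have := zeta_sq
  rw [h] at this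
  norm_num at this

theorem one_add_zeta_sq : (1 + zeta) ^ 2 = 3 * zeta := by
  linear_combination zeta_sq

theorem one_add_zeta_ne_zero : 1 + zeta ≠ 0 := by
  intro h
  have := one_add_zeta_sq
  rw [h] at this
  exact zeta_ne_zero (by linear_combination -this / 3)

theorem one_add_zeta_pow_six : (1 + zeta) ^ 6 = -27 := by
  have h := one_add_zeta_sq
  have : (1 + zeta) ^ 6 = ((1 + zeta) ^ 2) ^ 3 := by ring
  rw [this, h]
  linear_combination 27 * (zeta + 1) * zeta_sq

/-- The homogeneous form of the endomorphism of the cubic induced by multiplication by `1 + ζ`. -/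
def phi (p : Fin 3 → ℂ) : Fin 3 → ℂ :=
  ![(1 + zeta) * p 0 * (p 1 ^ 2 + 3 * p 2 ^ 2), p 1 * (p 1 ^ 2 - 9 * p 2 ^ 2),
    (1 + zeta) ^ 3 * (p 2 * (p 1 ^ 2 - p 2 ^ 2))]

/-- The derivative of `phi` at `p` in the direction `v`. -/
def dphi (p v : Fin 3 → ℂ) : Fin 3 → ℂ :=
  ![(1 + zeta) * (v 0 * (p 1 ^ 2 + 3 * p 2 ^ 2) + p 0 * (2 * p 1 * v 1 + 6 * p 2 * v 2)),
    v 1 * (p 1 ^ 2 - 9 * p 2 ^ 2) + p 1 * (2 * p 1 * v 1 - 18 * p 2 * v 2),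
    (1 + zeta) ^ 3 * (v 2 * (p 1 ^ 2 - p 2 ^ 2) + p 2 * (2 * p 1 * v 1 - 2 * p 2 * v 2))]

theorem phi_smul (a : ℂ) (p : Fin 3 → ℂ) : phi (a • p) = a ^ 3 • phi p := by
  ext i
  fin_cases i <;> simp [phi] <;> ring

/-- With A = W², B = Z², everything rests on A(A - 9B)² + 27B(A - B)² = (A + 3B)³. The 27 comes from
(1 + ζ)⁶ = -27, and on the cubic Z(A - B) = X³. -/
theorem OnCubic.phi {p : Fin 3 → ℂ} (h : OnCubic p) : OnCubic (phi p) := by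
  simp only [OnCubic, ZetaCurve.phi, Matrix.cons_val] at *
  have h6 := one_add_zeta_pow_six
  have e : ((1 + zeta) ^ 3 * (p 2 * (p 1 ^ 2 - p 2 ^ 2))) ^ 3 =
      (1 + zeta) ^ 3 * (-27) * (p 2 * (p 1 ^ 2 - p 2 ^ 2)) ^ 3 := by
    rw [← h6]; ring
  rw [e]
  linear_combination (1 + zeta) ^ 3 * (p 1 ^ 2 + 3 * p 2 ^ 2) ^ 3 * h

theorem phi_ne_zero {p : Fin 3 → ℂ} (hp : p ≠ 0) (h : OnCubic p) : phi p ≠ 0 := by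
  intro e
  have h1 : p 1 * (p 1 ^ 2 - 9 * p 2 ^ 2) = 0 := congrFun e 1
  have h2 : (1 + zeta) ^ 3 * (p 2 * (p 1 ^ 2 - p 2 ^ 2)) = 0 := congrFun e 2
  have h2' : p 2 * (p 1 ^ 2 - p 2 ^ 2) = 0 :=
    (mul_eq_zero.mp h2).resolve_left (pow_ne_zero 3 one_add_zeta_ne_zero)
  unfold OnCubic at h
  have h0 : p 0 = 0 := by
    have : p 0 ^ 3 = 0 := by linear_combination h2' - h
    exact pow_eq_zero_iff (by norm_num) |>.mp this
  have h12 : p 1 = 0 ∧ p 2 = 0 := by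
    rcases mul_eq_zero.mp h2' with h2 | h2
    · rw [h2] at h1
      have : p 1 ^ 3 = 0 := by linear_combination h1
      exact ⟨pow_eq_zero_iff (by norm_num) |>.mp this, h2⟩
    · have e1 : p 1 ^ 3 = 0 := by linear_combination (-1 / 8 : ℂ) * h1 + (9 / 8 : ℂ) * p 1 * h2
      have e1' : p 1 = 0 := pow_eq_zero_iff (by norm_num) |>.mp e1
      refine ⟨e1', ?_⟩
      rw [e1'] at h2
      have : p 2 ^ 2 = 0 := by linear_combination -h2
      exact pow_eq_zero_iff (by norm_num) |>.mp this
  apply hp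
  ext i
  fin_cases i
  · exact h0
  · exact h12.1
  · exact h12.2

/-- The pullback of `ψ` under `phi` is `(1 + ζ) ψ`. -/
theorem psi_phi {p v : Fin 3 → ℂ} (hp : p ≠ 0) (h : OnCubic p) (hv : IsTangent p v) :
    psi (phi p) (dphi p v) = (1 + zeta) * psi p v := by
  obtain ⟨k0, k1, k2⟩ := psi_mul_gradF hp h hv
  have hq := h.phi
  have hq0 := phi_ne_zero hp h
  have hv' : IsTangent (phi p) (dphi p v) := by
    have h6 := one_add_zeta_pow_six
    simp only [IsTangent, gradF, OnCubic, phi, dphi, Matrix.cons_val] at *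
    linear_combination (1 + zeta) ^ 3 * (p 1 ^ 2 + 3 * p 2 ^ 2) ^ 3 * hv +
      3 * (1 + zeta) ^ 3 * (p 1 ^ 2 + 3 * p 2 ^ 2) ^ 2 * (2 * p 1 * v 1 + 6 * p 2 * v 2) * h -
      3 * (1 + zeta) ^ 3 * (p 2 * (p 1 ^ 2 - p 2 ^ 2)) ^ 2 *
        (v 2 * (p 1 ^ 2 - p 2 ^ 2) + p 2 * (2 * p 1 * v 1 - 2 * p 2 * v 2)) * h6
  obtain ⟨l0, l1, l2⟩ := psi_mul_gradF hq0 hq hv'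
  have hg := gradF_ne_zero hq0
  -- `psi` is pinned down by ψ · grad F = -6 p × v, so it is enough to compare these vectors at `phi
  -- p`. By Euler's relation phi(p) = J p / 3 with J the Jacobian, hence phi(p) × J v = cof(J)(p ×
  -- v) / 3; the coefficients of `k0`, `k1`, `k2` below are the rows of cof(J)/3.
  have key : ∀ i, (1 + zeta) * psi p v * gradF (phi p) i =
      psi (phi p) (dphi p v) * gradF (phi p) i := by
    generalize psi (phi p) (dphi p v) = r at *
    generalize psi p v = s at *
    have h6 := one_add_zeta_pow_six
    intro i
    fin_cases i
    · simp only [Fin.zero_eta, l0]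
      simp only [OnCubic, gradF, phi, dphi, Matrix.cons_val] at *
      linear_combination (1 + zeta) ^ 3 * (p 1 ^ 2 + 3 * p 2 ^ 2) ^ 2 * k0
    · simp only [Fin.mk_one, l1]
      simp only [OnCubic, gradF, phi, dphi, Matrix.cons_val] at *
      linear_combination (1 + zeta) ^ 4 / 3 * (-2 * p 0 * p 1 * (p 1 ^ 2 - 9 * p 2 ^ 2) * k0 +
        (p 1 ^ 2 + 3 * p 2 ^ 2) * (p 1 ^ 2 - 3 * p 2 ^ 2) * k1 -
        2 * (p 1 ^ 2 + 3 * p 2 ^ 2) * p 1 * p 2 * k2) +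
        2 * s * (1 + zeta) ^ 4 * p 1 * (p 1 ^ 2 - 9 * p 2 ^ 2) * h
    · simp only [Fin.reduceFinMk, l2]
      simp only [OnCubic, gradF, phi, dphi, Matrix.cons_val] at *
      linear_combination (1 + zeta) * (-18 * p 0 * p 2 * (p 1 ^ 2 - p 2 ^ 2) * k0 +
        6 * (p 1 ^ 2 + 3 * p 2 ^ 2) * p 1 * p 2 * k1 +
        (p 1 ^ 2 + 3 * p 2 ^ 2) * (p 1 ^ 2 - 3 * p 2 ^ 2) * k2) +
        54 * s * (1 + zeta) * p 2 * (p 1 ^ 2 - p 2 ^ 2) * h -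
        3 * s * (1 + zeta) * p 2 ^ 2 * (p 1 ^ 2 - p 2 ^ 2) ^ 2 * h6
  obtain ⟨i, hi⟩ := Function.ne_iff.mp hg
  exact (mul_right_cancel₀ hi (key i)).symm

/-- Polar form of 1 + ζ; it explains the constant in the u-coordinate of the formula. -/
theorem ex_mul_sqrt_three : ex (1 / 12) * (Real.sqrt 3 : ℂ) = 1 + zeta := by
  have h3 : (Real.sqrt 3 : ℂ) ^ 2 = 3 := by
    rw [← Complex.ofReal_pow, Real.sq_sqrt (by norm_num)]; norm_num
  have : ex (1 / 12) = (Real.sqrt 3 + Complex.I) / 2 := by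
    unfold ex
    rw [show 2 * (Real.pi : ℂ) * Complex.I * (1 / 12) = ((Real.pi / 6 : ℝ) : ℂ) * Complex.I by
      push_cast; ring, Complex.exp_mul_I, ← Complex.ofReal_cos, ← Complex.ofReal_sin,
      Real.cos_pi_div_six, Real.sin_pi_div_six]
    push_cast; ring
  rw [this, zeta]
  linear_combination (1 / 2 : ℂ) * h3

/-- The endomorphism of the cubic given by `phi`. -/
def phiMap (P : CurveC) : CurveC :=
  point (phi P.1.rep) (phi_ne_zero P.1.rep_nonzero P.2) (OnCubic.phi P.2)

theorem mk_phi_eq {p q : Fin 3 → ℂ} (hp : p ≠ 0) (hq : q ≠ 0) (hp' : phi p ≠ 0) (hq' : phi q ≠ 0)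
    (h : Projectivization.mk ℂ p hp = Projectivization.mk ℂ q hq) :
    Projectivization.mk ℂ (phi p) hp' = Projectivization.mk ℂ (phi q) hq' := by
  rw [Projectivization.mk_eq_mk_iff'] at h ⊢
  obtain ⟨a, rfl⟩ := h
  exact ⟨a ^ 3, (phi_smul a q).symm⟩

theorem phiMap_val {P : CurveC} {p : Fin 3 → ℂ} (hp : p ≠ 0) (hp' : phi p ≠ 0)
    (h : Projectivization.mk ℂ p hp = P.1) :
    (phiMap P).1 = Projectivization.mk ℂ (phi p) hp' := by
  refine mk_phi_eq P.1.rep_nonzero hp _ hp' ?_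
  rw [h, Projectivization.mk_rep]

theorem continuous_phi : Continuous phi := by
  unfold phi
  refine continuous_pi fun i => ?_
  fin_cases i <;> simp <;> fun_prop

/-- `phi` has zeros off the cubic, so it does not descend to the whole projective plane. The
preimage of an open set is therefore described as the trace on the curve of an open set of the plane
on which `phi` is non-zero, and openness is tested on vectors through the quotient topology. -/
theorem continuous_phiMap : Continuous phiMap := by
  refine Continuous.subtype_mk ?_ _
  rw [continuous_def]
  intro V hV
  rw [isOpen_coinduced] at hV
  refine isOpen_induced_iff.mpr
    ⟨{x | ∃ h : phi x.rep ≠ 0, Projectivization.mk ℂ (phi x.rep) h ∈ V}, ?_, ?_⟩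
  · rw [isOpen_coinduced]
    have e : (Projectivization.mk' ℂ : {v : Fin 3 → ℂ // v ≠ 0} → ℙ ℂ (Fin 3 → ℂ)) ⁻¹'
        {x | ∃ h : phi x.rep ≠ 0, Projectivization.mk ℂ (phi x.rep) h ∈ V} =
        {v | ∃ h : phi v.1 ≠ 0, Projectivization.mk ℂ (phi v.1) h ∈ V} := by
      ext v
      have hv : Projectivization.mk ℂ v.1 v.2 =
        Projectivization.mk ℂ _ (Projectivization.mk' ℂ v).rep_nonzero := by
        rw [Projectivization.mk_rep]; rfl
      have hiff : phi (Projectivization.mk' ℂ v).rep ≠ 0 ↔ phi v.1 ≠ 0 := by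
        obtain ⟨a, ha⟩ := Projectivization.exists_smul_eq_mk_rep ℂ v.1 v.2
        rw [Projectivization.mk'_eq_mk, ← ha]
        change phi ((a : ℂ) • v.1) ≠ 0 ↔ _
        rw [phi_smul]
        simp
      constructor
      · rintro ⟨h, h'⟩
        refine ⟨hiff.mp h, ?_⟩
        rwa [mk_phi_eq v.2 _ _ h hv]
      · rintro ⟨h, h'⟩
        refine ⟨hiff.mpr h, ?_⟩
        rwa [← mk_phi_eq v.2 _ h (hiff.mpr h) hv]
    rw [e]
    have hU : IsOpen {v : {v : Fin 3 → ℂ // v ≠ 0} | phi v.1 ≠ 0} :=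
      isOpen_ne.preimage (continuous_phi.comp continuous_subtype_val)
    let f : {v : {v : Fin 3 → ℂ // v ≠ 0} // phi v.1 ≠ 0} → {v : Fin 3 → ℂ // v ≠ 0} :=
      fun v => ⟨phi v.1.1, v.2⟩
    have hf : Continuous f := Continuous.subtype_mk
      (continuous_phi.comp (continuous_subtype_val.comp continuous_subtype_val)) _
    have := hU.isOpenMap_subtype_val _ (hV.preimage hf)
    convert this using 1
    ext v
    constructor
    · rintro ⟨h, h'⟩
      exact ⟨⟨v, h⟩, h', rfl⟩
    · rintro ⟨⟨w, hw⟩, hw', rfl⟩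
      exact ⟨hw, hw'⟩
  · ext P
    exact ⟨fun ⟨_, h⟩ => h, fun h => ⟨_, h⟩⟩

/-- Shows that the image lies over t = ∞ exactly when W² + 3Z² = 0, which for a finite point is 4t =
3. -/
theorem phi_sq_sub_sq {p : Fin 3 → ℂ} :
    phi p 1 ^ 2 - phi p 2 ^ 2 = (p 1 ^ 2 + 3 * p 2 ^ 2) ^ 3 := by
  simp only [phi, Matrix.cons_val]
  linear_combination -(p 2 * (p 1 ^ 2 - p 2 ^ 2)) ^ 2 * one_add_zeta_pow_six

theorem four_mul_tCoord_sub (P : CurveC) (hP : IsFinite P) : 4 * tCoord P - 3 =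
    (P.1.rep 1 ^ 2 + 3 * P.1.rep 2 ^ 2) / (P.1.rep 1 ^ 2 - P.1.rep 2 ^ 2) := by
  unfold IsFinite at hP
  unfold tCoord tFun
  field_simp
  ring

theorem phiMap_coord (P : CurveC) (hP : IsFinite P) (ht : 4 * tCoord P - 3 ≠ 0) :
    IsFinite (phiMap P) ∧
    tCoord (phiMap P) = tCoord P * (9 - 8 * tCoord P) ^ 2 / (4 * tCoord P - 3) ^ 3 ∧
    uCoord (phiMap P) = ex (1 / 12) * (Real.sqrt 3 : ℂ) * uCoord P *
      (9 - 8 * tCoord P) / (4 * tCoord P - 3) ^ 2 := by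
  have h4 := four_mul_tCoord_sub P hP
  rw [h4] at ht
  have hA : P.1.rep 1 ^ 2 + 3 * P.1.rep 2 ^ 2 ≠ 0 := fun e => ht (by rw [e, zero_div])
  have h9 : 9 - 8 * tCoord P =
      (P.1.rep 1 ^ 2 - 9 * P.1.rep 2 ^ 2) / (P.1.rep 1 ^ 2 - P.1.rep 2 ^ 2) := by
    unfold IsFinite at hP
    unfold tCoord tFun
    field_simp
    ring
  rw [h4, h9, ex_mul_sqrt_three]
  unfold IsFinite at hP
  refine ⟨?_, ?_, ?_⟩
  · rw [phiMap, isFinite_point, phi_sq_sub_sq]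
    exact pow_ne_zero 3 hA
  · rw [phiMap, tCoord_point, tFun, phi_sq_sub_sq, tCoord, tFun]
    simp only [phi, Matrix.cons_val]
    field_simp
  · rw [phiMap, uCoord_point, uFun, phi_sq_sub_sq, uCoord, uFun]
    simp only [phi, Matrix.cons_val]
    field_simp

theorem not_isFinite_phiMap (P : CurveC) (hP : IsFinite P) (ht : 4 * tCoord P - 3 = 0) :
    ¬ IsFinite (phiMap P) := by
  rw [four_mul_tCoord_sub P hP] at ht
  unfold IsFinite at hP
  have hA : P.1.rep 1 ^ 2 + 3 * P.1.rep 2 ^ 2 = 0 := (div_eq_zero_iff.mp ht).resolve_right hP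
  rw [phiMap, isFinite_point, phi_sq_sub_sq, hA]
  norm_num

/-- On the cubic X³ = Z(W² - Z²), so over t = ∞ also X = 0, and the outer two coordinates of `phi`
vanish. These points and P₁ form the kernel of the isogeny. -/
theorem phiMap_of_not_isFinite (P : CurveC) (hP : ¬ IsFinite P) : phiMap P = P1 := by
  unfold IsFinite at hP
  rw [not_not] at hP
  have h0 : P.1.rep 0 = 0 := by
    have h : OnCubic P.1.rep := P.2
    unfold OnCubic at h
    have : P.1.rep 0 ^ 3 = 0 := by linear_combination P.1.rep 2 * hP - h
    exact pow_eq_zero_iff (by norm_num) |>.mp this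
  apply Subtype.ext
  change Projectivization.mk ℂ _ _ = Projectivization.mk ℂ _ _
  rw [Projectivization.mk_eq_mk_iff']
  refine ⟨phi P.1.rep 1, ?_⟩
  ext i
  fin_cases i <;> simp [phi, h0, hP]

theorem phiMap_P1 : phiMap P1 = P1 := by
  apply Subtype.ext
  have h1 : phi ![0, 1, 0] = ![0, 1, 0] := by
    ext i
    fin_cases i <;> simp [phi]
  have h2 : phi ![0, 1, 0] ≠ 0 := by rw [h1]; exact vec_inf_ne_zero
  rw [phiMap_val (p := ![0, 1, 0]) vec_inf_ne_zero h2 rfl]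
  simp only [h1]
  rfl

/-! ### The hexagonal lattice and the symmetries of its Weierstrass functions. -/

section

open scoped PeriodPair

theorem zeta_re : zeta.re = 1 / 2 := by simp [zeta]

theorem zeta_im : zeta.im = Real.sqrt 3 / 2 := by simp [zeta]

theorem zeta_cube : zeta ^ 3 = -1 := by linear_combination (zeta + 1) * zeta_sq

theorem conj_zeta : (starRingEnd ℂ) zeta = 1 - zeta := by
  apply Complex.ext
  · simp [zeta_re]; norm_num
  · simp [zeta_im]

/-- The pair of periods `ζ, 1`. -/
def hexPair : PeriodPair where
  ω₁ := zeta
  ω₂ := 1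
  indep := by
    rw [LinearIndependent.pair_iff]
    intro s t h
    have him := congrArg Complex.im h
    have hre := congrArg Complex.re h
    simp [zeta_im, zeta_re] at him hre
    subst him
    simpa using hre

theorem mem_hexPair_lattice {z : ℂ} :
    z ∈ hexPair.lattice ↔ ∃ m n : ℤ, (m : ℂ) * zeta + n = z := by
  simp [PeriodPair.mem_lattice, hexPair]

theorem mem_hexPair_lattice_iff_mem_latticeL {z : ℂ} : z ∈ hexPair.lattice ↔ z ∈ latticeL := by
  rw [mem_hexPair_lattice, latticeL, AddSubgroup.mem_closure_pair]
  simp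

theorem intCast_coord_unique {m n : ℤ} {a b : ℝ} (h : (m : ℂ) * zeta + n = a * zeta + b) :
    (m : ℝ) = a ∧ (n : ℝ) = b := by
  have him := congrArg Complex.im h
  have hre := congrArg Complex.re h
  have h3 : Real.sqrt 3 ≠ 0 := by positivity
  simp [zeta_im, zeta_re] at him hre
  have : (m : ℝ) = a := him
  subst this
  exact ⟨rfl, by simpa using hre⟩

theorem mem_hexPair_lattice_coord {a b : ℝ} :
    (a * zeta + b : ℂ) ∈ hexPair.lattice ↔ (∃ m : ℤ, (m : ℝ) = a) ∧ ∃ n : ℤ, (n : ℝ) = b := by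
  rw [mem_hexPair_lattice]
  constructor
  · rintro ⟨m, n, h⟩
    obtain ⟨h1, h2⟩ := intCast_coord_unique h
    exact ⟨⟨m, h1⟩, n, h2⟩
  · rintro ⟨⟨m, rfl⟩, n, rfl⟩
    exact ⟨m, n, by simp⟩

theorem zeta_mul_mem {z : ℂ} (hz : z ∈ hexPair.lattice) : zeta * z ∈ hexPair.lattice := by
  obtain ⟨m, n, rfl⟩ := mem_hexPair_lattice.mp hz
  refine mem_hexPair_lattice.mpr ⟨m + n, -m, ?_⟩
  push_cast
  linear_combination -(m : ℂ) * zeta_sq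

theorem conj_mem {z : ℂ} (hz : z ∈ hexPair.lattice) :
    (starRingEnd ℂ) z ∈ hexPair.lattice := by
  obtain ⟨m, n, rfl⟩ := mem_hexPair_lattice.mp hz
  refine mem_hexPair_lattice.mpr ⟨-m, m + n, ?_⟩
  simp [conj_zeta]
  ring

/-- Multiplication by `ζ` on the lattice. -/
def zetaEquiv : hexPair.lattice ≃ hexPair.lattice where
  toFun l := ⟨zeta * l, zeta_mul_mem l.2⟩
  invFun l := ⟨-(zeta * (zeta * l)), hexPair.lattice.neg_mem (zeta_mul_mem (zeta_mul_mem l.2))⟩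
  left_inv l := by
    ext
    simp only
    linear_combination -(l : ℂ) * zeta_cube
  right_inv l := by
    ext
    simp only
    linear_combination -(l : ℂ) * zeta_cube

/-- Complex conjugation on the lattice. -/
def conjEquiv : hexPair.lattice ≃ hexPair.lattice where
  toFun l := ⟨(starRingEnd ℂ) l, conj_mem l.2⟩
  invFun l := ⟨(starRingEnd ℂ) l, conj_mem l.2⟩
  left_inv l := by ext; simp
  right_inv l := by ext; simp

theorem weierstrassP_zeta_mul (z : ℂ) : ℘[hexPair] (zeta * z) = -zeta * ℘[hexPair] z := by
  have hz := zeta_ne_zero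
  have h3 := zeta_cube
  unfold PeriodPair.weierstrassP
  rw [← zetaEquiv.tsum_eq, ← tsum_mul_left]
  refine tsum_congr fun l => ?_
  change 1 / (zeta * z - zeta * l) ^ 2 - 1 / (zeta * l) ^ 2 = _
  have : (-zeta : ℂ) = 1 / zeta ^ 2 := by field_simp; linear_combination -h3
  rw [this, ← mul_sub, mul_pow, mul_pow, mul_sub, div_mul_div_comm, div_mul_div_comm, mul_one]

theorem derivWeierstrassP_zeta_mul (z : ℂ) : ℘'[hexPair] (zeta * z) = -℘'[hexPair] z := by
  unfold PeriodPair.derivWeierstrassP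
  rw [← zetaEquiv.tsum_eq, ← tsum_neg, ← tsum_neg, ← tsum_neg]
  refine tsum_congr fun l => ?_
  change -(2 / (zeta * z - zeta * l) ^ 3) = _
  rw [← mul_sub, mul_pow, zeta_cube, neg_one_mul, div_neg]

theorem weierstrassP_conj (z : ℂ) :
    ℘[hexPair] ((starRingEnd ℂ) z) = (starRingEnd ℂ) (℘[hexPair] z) := by
  unfold PeriodPair.weierstrassP
  rw [← conjEquiv.tsum_eq, Complex.conj_tsum]
  refine tsum_congr fun l => ?_
  simp [conjEquiv]

/-- Summing over ζL = L gives G₄ = ζ⁻⁴ G₄ = ζ² G₄, and ζ² ≠ 1. -/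
theorem hexPair_g₂ : hexPair.g₂ = 0 := by
  have h : hexPair.G 4 = zeta ^ 2 * hexPair.G 4 := by
    unfold PeriodPair.G
    conv_lhs => rw [← zetaEquiv.tsum_eq]
    rw [← tsum_mul_left]
    refine tsum_congr fun l => ?_
    change ((zeta * l) ^ 4)⁻¹ = _
    have : (zeta ^ 4)⁻¹ = zeta ^ 2 := by
      refine inv_eq_of_mul_eq_one_right ?_
      linear_combination (zeta ^ 3 - 1) * zeta_cube
    rw [mul_pow, mul_inv, this]
  have h0 : (1 - zeta ^ 2) * hexPair.G 4 = 0 := by linear_combination h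
  have h1 : 1 - zeta ^ 2 ≠ 0 := by
    rw [zeta_sq]
    intro e
    have := congrArg Complex.im e
    simp [zeta_im] at this
  rw [PeriodPair.g₂, (mul_eq_zero.mp h0).resolve_left h1, mul_zero]

theorem derivWeierstrassP_sq {z : ℂ} (hz : z ∉ hexPair.lattice) :
    ℘'[hexPair] z ^ 2 = 4 * ℘[hexPair] z ^ 3 - hexPair.g₃ := by
  rw [hexPair.derivWeierstrassP_sq z hz, hexPair_g₂, zero_mul, sub_zero]

end

/-! ### Behaviour of ℘ at its poles and the equation ℘'' = 6℘². -/

section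

open scoped PeriodPair
open Filter Topology

theorem isOpen_compl_hexLattice : IsOpen ((hexPair.lattice : Set ℂ)ᶜ) :=
  hexPair.isClosed_lattice.isOpen_compl

theorem countable_hexLattice : (hexPair.lattice : Set ℂ).Countable := by
  have : (hexPair.lattice : Set ℂ) = Set.range fun x : ℤ × ℤ => (x.1 : ℂ) * zeta + x.2 := by
    ext z
    simp [mem_hexPair_lattice]
  rw [this]
  exact Set.countable_range _

theorem isPreconnected_compl_of_countable {s : Set ℂ} (hs : s.Countable) :
    IsPreconnected sᶜ :=
  (hs.isConnected_compl_of_one_lt_rank (by simp)).isPreconnected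

theorem analyticAt_weierstrassP {z : ℂ} (hz : z ∉ hexPair.lattice) :
    AnalyticAt ℂ ℘[hexPair] z :=
  hexPair.analyticOnNhd_weierstrassP z hz

theorem analyticAt_derivWeierstrassP {z : ℂ} (hz : z ∉ hexPair.lattice) :
    AnalyticAt ℂ ℘'[hexPair] z :=
  hexPair.analyticOnNhd_derivWeierstrassP z hz

theorem hasDerivAt_weierstrassP {z : ℂ} (hz : z ∉ hexPair.lattice) :
    HasDerivAt ℘[hexPair] (℘'[hexPair] z) z := by
  rw [← hexPair.deriv_weierstrassP]
  exact (analyticAt_weierstrassP hz).differentiableAt.hasDerivAt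

theorem sq_mul_weierstrassP {z : ℂ} (hz : z ≠ 0) :
    z ^ 2 * ℘[hexPair] z = z ^ 2 * hexPair.weierstrassPExcept 0 z + 1 := by
  have := hexPair.weierstrassPExcept_add 0 z
  simp at this
  rw [← this]
  field_simp

theorem cube_mul_derivWeierstrassP {z : ℂ} (hz : z ≠ 0) :
    z ^ 3 * ℘'[hexPair] z = z ^ 3 * hexPair.derivWeierstrassPExcept 0 z - 2 := by
  have := hexPair.derivWeierstrassPExcept_sub 0 z
  simp at this
  rw [← this]
  field_simp

theorem tendsto_sq_mul_weierstrassP :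
    Tendsto (fun z => z ^ 2 * ℘[hexPair] z) (𝓝[≠] 0) (𝓝 1) := by
  have h : ContinuousAt (fun z => z ^ 2 * hexPair.weierstrassPExcept 0 z + 1) 0 := by
    have := (hexPair.analyticAt_weierstrassPExcept 0).continuousAt
    fun_prop
  have h' : Tendsto (fun z => z ^ 2 * hexPair.weierstrassPExcept 0 z + 1) (𝓝[≠] 0) (𝓝 1) := by
    simpa using h.tendsto.mono_left nhdsWithin_le_nhds
  refine h'.congr' ?_
  filter_upwards [self_mem_nhdsWithin] with z hz
  exact (sq_mul_weierstrassP hz).symm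

theorem tendsto_cube_mul_derivWeierstrassP :
    Tendsto (fun z => z ^ 3 * ℘'[hexPair] z) (𝓝[≠] 0) (𝓝 (-2)) := by
  have h : ContinuousAt (fun z => z ^ 3 * hexPair.derivWeierstrassPExcept 0 z - 2) 0 := by
    have := (hexPair.analyticAt_derivWeierstrassPExcept 0).continuousAt
    fun_prop
  have h' : Tendsto (fun z => z ^ 3 * hexPair.derivWeierstrassPExcept 0 z - 2) (𝓝[≠] 0)
      (𝓝 (-2)) := by
    simpa using h.tendsto.mono_left nhdsWithin_le_nhds
  refine h'.congr' ?_
  filter_upwards [self_mem_nhdsWithin] with z hz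
  exact (cube_mul_derivWeierstrassP hz).symm

theorem tendsto_norm_weierstrassP :
    Tendsto (fun z => ‖℘[hexPair] z‖) (𝓝[≠] 0) atTop := by
  have h1 : Tendsto (fun z : ℂ => ‖z ^ 2 * ℘[hexPair] z‖) (𝓝[≠] 0) (𝓝 1) := by
    simpa using tendsto_sq_mul_weierstrassP.norm
  have h2 : Tendsto (fun z : ℂ => ‖z ^ 2‖⁻¹) (𝓝[≠] 0) atTop := by
    refine tendsto_inv_nhdsGT_zero.comp (tendsto_nhdsWithin_iff.mpr ⟨?_, ?_⟩)
    · have : ContinuousAt (fun z : ℂ => ‖z ^ 2‖) 0 := by fun_prop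
      simpa using this.tendsto.mono_left nhdsWithin_le_nhds
    · filter_upwards [self_mem_nhdsWithin] with z hz
      exact norm_pos_iff.mpr (pow_ne_zero 2 hz)
  refine (h2.atTop_mul_pos one_pos h1).congr' ?_
  filter_upwards [self_mem_nhdsWithin] with z hz
  have : z ≠ 0 := hz
  rw [norm_mul, inv_mul_cancel_left₀]
  simpa using this

/-- Near `0` only `0` is a lattice point. -/
theorem eventually_notMem_lattice : ∀ᶠ z in 𝓝[≠] (0 : ℂ), z ∉ hexPair.lattice := by
  have := hexPair.compl_lattice_sdiff_singleton_mem_nhds 0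
  filter_upwards [nhdsWithin_le_nhds this, self_mem_nhdsWithin] with z hz hz0 h
  exact hz ⟨h, hz0⟩

/-- Differentiating ℘'² = 4℘³ - g₃ gives ℘'(℘'' - 6℘²) = 0. Analytic functions on the connected
complement of the lattice have no zero divisors, and ℘' is not identically zero because z³℘' tends
to -2 at 0. -/
theorem hasDerivAt_derivWeierstrassP {z : ℂ} (hz : z ∉ hexPair.lattice) :
    HasDerivAt ℘'[hexPair] (6 * ℘[hexPair] z ^ 2) z := by
  have key : ∀ w ∈ (hexPair.lattice : Set ℂ)ᶜ,
      ℘'[hexPair] w * (deriv ℘'[hexPair] w - 6 * ℘[hexPair] w ^ 2) = 0 := by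
    intro w hw
    have h1 := ((analyticAt_derivWeierstrassP hw).differentiableAt.hasDerivAt).pow 2
    have h2 := (((hasDerivAt_weierstrassP hw).pow 3).const_mul 4).sub_const hexPair.g₃
    have h3 : ℘'[hexPair] ^ 2 =ᶠ[𝓝 w] fun x => 4 * (℘[hexPair] ^ 3) x - hexPair.g₃ := by
      filter_upwards [isOpen_compl_hexLattice.mem_nhds hw] with x hx
      exact derivWeierstrassP_sq hx
    have h4 := h1.unique (h2.congr_of_eventuallyEq h3)
    simp at h4
    linear_combination h4 / 2
  have hA : AnalyticOnNhd ℂ ℘'[hexPair] (hexPair.lattice : Set ℂ)ᶜ :=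
    hexPair.analyticOnNhd_derivWeierstrassP
  have hB : AnalyticOnNhd ℂ (fun w => deriv ℘'[hexPair] w - 6 * ℘[hexPair] w ^ 2)
      (hexPair.lattice : Set ℂ)ᶜ := fun w hw =>
    (hA w hw).deriv.sub (analyticAt_const.mul ((analyticAt_weierstrassP hw).pow 2))
  have h := AnalyticOnNhd.eq_zero_or_eq_zero_of_mul_eq_zero hA hB key
    (isPreconnected_compl_of_countable countable_hexLattice)
  have h0 : ∀ w ∈ (hexPair.lattice : Set ℂ)ᶜ, deriv ℘'[hexPair] w - 6 * ℘[hexPair] w ^ 2 = 0 := by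
    refine h.resolve_left fun h => ?_
    have : Tendsto (fun z => z ^ 3 * ℘'[hexPair] z) (𝓝[≠] 0) (𝓝 0) := by
      refine tendsto_const_nhds.congr' ?_
      filter_upwards [eventually_notMem_lattice] with w hw
      rw [h w hw, mul_zero]
    have := tendsto_nhds_unique this tendsto_cube_mul_derivWeierstrassP
    norm_num at this
  rw [← sub_eq_zero.mp (h0 z hz)]
  exact (hA z hz).differentiableAt.hasDerivAt

/-- Two solutions of `f'' = 6 f²` with the same initial values agree. -/
theorem eventuallyEq_of_deriv_deriv {f g : ℂ → ℂ} {z : ℂ} (hf : AnalyticAt ℂ f z)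
    (hg : AnalyticAt ℂ g z) (hf2 : ∀ᶠ w in 𝓝 z, deriv (deriv f) w = 6 * f w ^ 2)
    (hg2 : ∀ᶠ w in 𝓝 z, deriv (deriv g) w = 6 * g w ^ 2) (h0 : f z = g z)
    (h1 : deriv f z = deriv g z) : f =ᶠ[𝓝 z] g := by
  set d : ℂ → ℂ := fun w => f w - g w with hd
  have hdA : AnalyticAt ℂ d z := hf.sub hg
  have hd0 : d z = 0 := by simp [hd, h0]
  have hd' : deriv d =ᶠ[𝓝 z] fun w => deriv f w - deriv g w := by
    filter_upwards [hf.eventually_analyticAt, hg.eventually_analyticAt] with w hfw hgw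
    exact deriv_fun_sub hfw.differentiableAt hgw.differentiableAt
  have hd1 : deriv d z = 0 := by rw [hd'.eq_of_nhds, h1, sub_self]
  have hd2 : deriv (deriv d) =ᶠ[𝓝 z] fun w => 6 * (f w + g w) * d w := by
    filter_upwards [hd'.deriv, hf.eventually_analyticAt, hg.eventually_analyticAt, hf2, hg2]
      with w hw hfw hgw hfw2 hgw2
    rw [hw, deriv_fun_sub hfw.deriv.differentiableAt hgw.deriv.differentiableAt, hfw2, hgw2]
    simp only [hd]
    ring
  have hord : analyticOrderAt (deriv (deriv d)) z = analyticOrderAt (fun w => 6 * (f w + g w)) z +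
      analyticOrderAt d z := by
    rw [analyticOrderAt_congr hd2]
    exact analyticOrderAt_mul (analyticAt_const.mul (hf.add hg)) hdA
  -- The equation d'' = 6(f + g)d makes d'' vanish at least as strongly as d, while d(z) = d'(z) = 0
  -- makes d vanish two orders more strongly than d''. Every lower bound for the order of d thus
  -- improves by 2, so the order is infinite.
  have htop : analyticOrderAt d z = ⊤ := by
    have key : ∀ n : ℕ, (n : ℕ∞) ≤ analyticOrderAt d z →
        ((n + 2 : ℕ) : ℕ∞) ≤ analyticOrderAt d z := by
      intro n hn
      have e : (n : ℕ∞) ≤ analyticOrderAt (deriv (deriv d)) z := by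
        rw [hord]; exact hn.trans le_add_self
      rw [analyticOrderAt_deriv_ge_iff hdA.deriv hd1] at e
      have e' : ((n + 1 : ℕ) : ℕ∞) ≤ analyticOrderAt (deriv d) z := by exact_mod_cast e
      rw [analyticOrderAt_deriv_ge_iff hdA hd0] at e'
      exact_mod_cast e'
    refine ENat.eq_top_iff_forall_ge.mpr fun m => ?_
    induction m with
    | zero => simp
    | succ k ih => exact le_trans (by exact_mod_cast Nat.le_succ _) (key k ih)
  rw [analyticOrderAt_eq_top] at htop
  filter_upwards [htop] with w hw
  exact sub_eq_zero.mp hw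

end

/-! ### Injectivity and surjectivity of (℘, ℘'), and values on the real line. -/

section

open scoped PeriodPair
open Filter Topology

theorem weierstrassP_add_mem (z : ℂ) {l : ℂ} (hl : l ∈ hexPair.lattice) :
    ℘[hexPair] (z + l) = ℘[hexPair] z :=
  hexPair.weierstrassP_add_coe z ⟨l, hl⟩

theorem derivWeierstrassP_add_mem (z : ℂ) {l : ℂ} (hl : l ∈ hexPair.lattice) :
    ℘'[hexPair] (z + l) = ℘'[hexPair] z :=
  hexPair.derivWeierstrassP_add_coe z ⟨l, hl⟩

/-- The map `(℘, ℘')` is injective on the torus. -/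
theorem sub_mem_of_weierstrassP_eq {z w : ℂ} (hz : z ∉ hexPair.lattice) (hw : w ∉ hexPair.lattice)
    (h : ℘[hexPair] z = ℘[hexPair] w) (h' : ℘'[hexPair] z = ℘'[hexPair] w) :
    w - z ∈ hexPair.lattice := by
  set δ := w - z with hδ
  by_contra hcon
  -- The translate by δ solves the same second-order equation with the same initial data at z, so it
  -- agrees with ℘ off both sets of poles. If δ is not a period the translate is regular at 0, where
  -- ℘ has a pole.
  set g : ℂ → ℂ := fun u => ℘[hexPair] (u + δ) with hg
  have hgd : deriv g = fun u => ℘'[hexPair] (u + δ) := by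
    funext u
    rw [hg, deriv_comp_add_const, hexPair.deriv_weierstrassP]
  set U : Set ℂ := ((hexPair.lattice : Set ℂ) ∪ (fun u => u + δ) ⁻¹' (hexPair.lattice : Set ℂ))ᶜ
    with hU
  have hUc : IsPreconnected U := isPreconnected_compl_of_countable
    (countable_hexLattice.union (countable_hexLattice.preimage (add_left_injective δ)))
  have hUmem : ∀ u, u ∈ U ↔ u ∉ hexPair.lattice ∧ u + δ ∉ hexPair.lattice := by
    intro u; simp [hU]
  have hga : ∀ u, u + δ ∉ hexPair.lattice → AnalyticAt ℂ g u := fun u hu =>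
    AnalyticAt.fun_comp (analyticAt_weierstrassP hu) (analyticAt_id.add analyticAt_const)
  have hwz : z + δ = w := by rw [hδ]; ring
  have hzU : z ∈ U := (hUmem z).mpr ⟨hz, by rwa [hwz]⟩
  have hloc : ℘[hexPair] =ᶠ[𝓝 z] g := by
    refine eventuallyEq_of_deriv_deriv (analyticAt_weierstrassP hz) (hga z (by rwa [hwz])) ?_ ?_
      ?_ ?_
    · filter_upwards [isOpen_compl_hexLattice.mem_nhds hz] with u hu
      rw [hexPair.deriv_weierstrassP]
      exact (hasDerivAt_derivWeierstrassP hu).deriv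
    · have : ∀ᶠ u in 𝓝 z, u + δ ∉ hexPair.lattice := by
        have hc : ContinuousAt (fun u => u + δ) z := by fun_prop
        refine hc.eventually (isOpen_compl_hexLattice.mem_nhds ?_)
        change z + δ ∉ hexPair.lattice
        rwa [hwz]
      filter_upwards [this] with u hu
      rw [hgd, deriv_comp_add_const]
      exact (hasDerivAt_derivWeierstrassP hu).deriv
    · rw [hg]; simp only; rw [hwz, h]
    · rw [hgd, hexPair.deriv_weierstrassP]; simp only; rw [hwz, h']
  have heq : Set.EqOn ℘[hexPair] g U :=
    AnalyticOnNhd.eqOn_of_preconnected_of_eventuallyEq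
      (fun u hu => analyticAt_weierstrassP ((hUmem u).mp hu).1)
      (fun u hu => hga u ((hUmem u).mp hu).2) hUc hzU hloc
  have hc0 : ContinuousAt g 0 := (hga 0 (by rwa [zero_add])).continuousAt
  refine not_tendsto_nhds_of_tendsto_atTop tendsto_norm_weierstrassP ‖g 0‖ ?_
  refine (hc0.norm.tendsto.mono_left nhdsWithin_le_nhds).congr' ?_
  have h2 : ∀ᶠ u in 𝓝 (0 : ℂ), u + δ ∉ hexPair.lattice := by
    have hc : ContinuousAt (fun u => u + δ) 0 := by fun_prop
    refine hc.eventually (isOpen_compl_hexLattice.mem_nhds ?_)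
    change 0 + δ ∉ hexPair.lattice
    rwa [zero_add]
  filter_upwards [eventually_notMem_lattice, nhdsWithin_le_nhds h2] with u hu hu'
  rw [heq ((hUmem u).mpr ⟨hu, hu'⟩)]

/-- Every complex number is congruent to one with coordinates at most `1 / 2`. -/
theorem exists_coord_le (z : ℂ) : ∃ a b : ℝ, |a| ≤ 1 / 2 ∧ |b| ≤ 1 / 2 ∧
    z - (a * zeta + b) ∈ hexPair.lattice := by
  have h3 : Real.sqrt 3 ≠ 0 := by positivity
  set a₀ : ℝ := z.im * 2 / Real.sqrt 3
  set b₀ : ℝ := z.re - a₀ / 2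
  refine ⟨a₀ - round a₀, b₀ - round b₀, abs_sub_round _, abs_sub_round _,
    mem_hexPair_lattice.mpr ⟨round a₀, round b₀, ?_⟩⟩
  have hz : z = a₀ * zeta + b₀ := by
    apply Complex.ext
    · simp [zeta_re, b₀]; ring
    · simp [zeta_im, a₀]; field_simp
  conv_rhs => rw [hz]
  push_cast
  ring

theorem ofReal_mem_lattice {s : ℝ} : (s : ℂ) ∈ hexPair.lattice ↔ ∃ n : ℤ, (n : ℝ) = s := by
  have := mem_hexPair_lattice_coord (a := 0) (b := s)
  simp only [Complex.ofReal_zero, zero_mul, zero_add] at this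
  rw [this, and_iff_right ⟨0, by simp⟩]

theorem half_notMem_lattice : (1 / 2 : ℂ) ∉ hexPair.lattice := by
  have : (1 / 2 : ℂ) = ((1 / 2 : ℝ) : ℂ) := by push_cast; rfl
  rw [this, ofReal_mem_lattice]
  rintro ⟨n, hn⟩
  have h2 : (2 * n : ℝ) = 1 := by linarith
  have : 2 * n = 1 := by exact_mod_cast h2
  omega

/-- The function `℘` takes every value. -/
theorem exists_weierstrassP_eq (a : ℂ) : ∃ z, z ∉ hexPair.lattice ∧ ℘[hexPair] z = a := by
  classical
  by_contra! hcon
  -- If a is omitted, 1/(℘ - a), extended by 0 at the poles of ℘, is entire and doubly periodic. By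
  -- Liouville it is constant, hence 0, which is impossible at 1/2.
  set h : ℂ → ℂ := fun z => if z ∈ hexPair.lattice then 0 else (℘[hexPair] z - a)⁻¹ with hh
  have hper : ∀ z l, l ∈ hexPair.lattice → h (z + l) = h z := by
    intro z l hl
    simp only [hh, hexPair.lattice.add_mem_iff_left hl, weierstrassP_add_mem z hl]
  have hd0 : DifferentiableAt ℂ h 0 := by
    have hE := (hexPair.analyticAt_weierstrassPExcept 0).differentiableAt
    have hD : DifferentiableAt ℂ (fun z : ℂ =>
        z ^ 2 / (z ^ 2 * hexPair.weierstrassPExcept 0 z + 1 - a * z ^ 2)) 0 := by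
      refine DifferentiableAt.div ?_ ?_ ?_
      · fun_prop
      · fun_prop
      · simp
    refine hD.congr_of_eventuallyEq ?_
    have hn := eventually_nhdsWithin_iff.mp eventually_notMem_lattice
    filter_upwards [hn] with z hz
    by_cases hz0 : z = 0
    · subst hz0
      simp [hh]
    · simp only [hh, if_neg (hz hz0)]
      rw [← sq_mul_weierstrassP hz0, show z ^ 2 * ℘[hexPair] z - a * z ^ 2 =
        z ^ 2 * (℘[hexPair] z - a) by ring, div_mul_cancel_left₀ (pow_ne_zero 2 hz0)]
  have hd : Differentiable ℂ h := by
    intro z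
    by_cases hz : z ∈ hexPair.lattice
    · have e : h = fun w => h (w - z) := by
        funext w
        rw [sub_eq_add_neg, hper w _ (hexPair.lattice.neg_mem hz)]
      rw [e]
      exact DifferentiableAt.comp (f := fun w => w - z) z (by simpa using hd0) (by fun_prop)
    · have hD : DifferentiableAt ℂ (fun w => (℘[hexPair] w - a)⁻¹) z :=
        ((analyticAt_weierstrassP hz).differentiableAt.sub_const a).inv
          (sub_ne_zero.mpr (hcon z hz))
      refine hD.congr_of_eventuallyEq ?_
      filter_upwards [isOpen_compl_hexLattice.mem_nhds hz] with w hw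
      exact if_neg hw
  have hb : Bornology.IsBounded (Set.range h) := by
    have hK : IsCompact (h '' Metric.closedBall 0 (‖zeta‖ + 1)) :=
      (isCompact_closedBall _ _).image hd.continuous
    refine hK.isBounded.subset ?_
    rintro _ ⟨z, rfl⟩
    obtain ⟨r, s, hr, hs, hl⟩ := exists_coord_le z
    refine ⟨r * zeta + s, ?_, ?_⟩
    · rw [mem_closedBall_zero_iff]
      refine (norm_add_le _ _).trans ?_
      rw [norm_mul, Complex.norm_real, Complex.norm_real, Real.norm_eq_abs, Real.norm_eq_abs]
      nlinarith [norm_nonneg zeta]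
    · rw [← hper _ _ hl]
      congr 1
      ring
  have hc := hd.apply_eq_apply_of_bounded hb (1 / 2) 0
  simp only [hh, if_neg half_notMem_lattice, if_pos hexPair.lattice.zero_mem] at hc
  exact hcon _ half_notMem_lattice (sub_eq_zero.mp (inv_eq_zero.mp hc))

theorem exists_weierstrassP_eq_and {x y : ℂ} (h : y ^ 2 = 4 * x ^ 3 - hexPair.g₃) :
    ∃ z, z ∉ hexPair.lattice ∧ ℘[hexPair] z = x ∧ ℘'[hexPair] z = y := by
  obtain ⟨z, hz, rfl⟩ := exists_weierstrassP_eq x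
  rw [← derivWeierstrassP_sq hz, sq_eq_sq_iff_eq_or_eq_neg] at h
  rcases h with rfl | rfl
  · exact ⟨z, hz, rfl, rfl⟩
  · exact ⟨-z, fun h => hz (by simpa using hexPair.lattice.neg_mem h), hexPair.weierstrassP_neg z,
      hexPair.derivWeierstrassP_neg z⟩

theorem derivWeierstrassP_conj (z : ℂ) :
    ℘'[hexPair] ((starRingEnd ℂ) z) = (starRingEnd ℂ) (℘'[hexPair] z) := by
  unfold PeriodPair.derivWeierstrassP
  rw [← conjEquiv.tsum_eq, map_neg, Complex.conj_tsum]
  congr 1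
  refine tsum_congr fun l => ?_
  simp [conjEquiv, Complex.conj_ofNat]

theorem two_mul_mem_of_derivWeierstrassP_eq_zero {z : ℂ} (hz : z ∉ hexPair.lattice)
    (h : ℘'[hexPair] z = 0) : 2 * z ∈ hexPair.lattice := by
  have hz' : -z ∉ hexPair.lattice := fun h => hz (by simpa using hexPair.lattice.neg_mem h)
  have := sub_mem_of_weierstrassP_eq hz' hz (hexPair.weierstrassP_neg z)
    (by rw [hexPair.derivWeierstrassP_neg, h, neg_zero])
  rwa [sub_neg_eq_add, ← two_mul] at this

theorem derivWeierstrassP_half : ℘'[hexPair] (1 / 2) = 0 := by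
  have h1 : (1 : ℂ) ∈ hexPair.lattice := mem_hexPair_lattice.mpr ⟨0, 1, by simp⟩
  have := derivWeierstrassP_add_mem (-(1 / 2)) h1
  rw [hexPair.derivWeierstrassP_neg, show -(1 / 2) + 1 = (1 / 2 : ℂ) by norm_num] at this
  exact self_eq_neg.mp this

theorem hexPair_g₃ : hexPair.g₃ = 4 * ℘[hexPair] (1 / 2) ^ 3 := by
  have := derivWeierstrassP_sq half_notMem_lattice
  rw [derivWeierstrassP_half] at this
  linear_combination this

/-- Otherwise the ζ-symmetry would give 1/2 and ζ/2 the same values (0, 0) of (℘, ℘'), although they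
are incongruent. -/
theorem weierstrassP_half_ne_zero : ℘[hexPair] (1 / 2) ≠ 0 := by
  intro h
  have hz : zeta * (1 / 2) ∉ hexPair.lattice := by
    intro h'
    have : (1 / 2 : ℂ) = -(zeta * (zeta * (zeta * (1 / 2)))) := by
      linear_combination (1 / 2 : ℂ) * zeta_cube
    exact half_notMem_lattice (this ▸ hexPair.lattice.neg_mem (zeta_mul_mem (zeta_mul_mem h')))
  have := sub_mem_of_weierstrassP_eq half_notMem_lattice hz
    (by rw [weierstrassP_zeta_mul, h, mul_zero])
    (by rw [derivWeierstrassP_zeta_mul, derivWeierstrassP_half, neg_zero])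
  have h2 := (mem_hexPair_lattice_coord (a := 1 / 2) (b := -1 / 2)).mp (by
    push_cast
    convert this using 1
    ring)
  obtain ⟨⟨n, hn⟩, -⟩ := h2
  have h2 : (2 * n : ℝ) = 1 := by linarith
  have : 2 * n = 1 := by exact_mod_cast h2
  omega

/-- On the real line the zeros of `℘` are excluded. -/
theorem weierstrassP_ofReal_ne_zero {s : ℝ} (hs : (s : ℂ) ∉ hexPair.lattice) :
    ℘[hexPair] s ≠ 0 := by
  intro h
  have hz : zeta * s ∉ hexPair.lattice := by
    intro h'
    have : (s : ℂ) = -(zeta * (zeta * (zeta * s))) := by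
      linear_combination (s : ℂ) * zeta_cube
    exact hs (this ▸ hexPair.lattice.neg_mem (zeta_mul_mem (zeta_mul_mem h')))
  have hs' : (-s : ℂ) ∉ hexPair.lattice := fun h => hs (by simpa using hexPair.lattice.neg_mem h)
  -- If ℘(s) = 0 then -s and ζs share their values of ℘ and ℘', so (ζ + 1)s is a period; its
  -- coordinates are (s, s), forcing s to be an integer.
  have := sub_mem_of_weierstrassP_eq hs' hz
    (by rw [weierstrassP_zeta_mul, hexPair.weierstrassP_neg, h, mul_zero])
    (by rw [derivWeierstrassP_zeta_mul, hexPair.derivWeierstrassP_neg])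
  have h2 := (mem_hexPair_lattice_coord (a := s) (b := s)).mp (by
    convert this using 1
    ring)
  exact hs (ofReal_mem_lattice.mpr h2.1)

end

/-! ### The real period as a beta integral. -/

section

open scoped PeriodPair
open Filter Topology Set

/-- The restriction of `℘` to the real line. -/
def realP (s : ℝ) : ℝ := (℘[hexPair] s).re

/-- The restriction of `℘'` to the real line. -/
def realP' (s : ℝ) : ℝ := (℘'[hexPair] s).re

theorem coe_realP (s : ℝ) : (realP s : ℂ) = ℘[hexPair] s := by
  have := weierstrassP_conj s
  rw [Complex.conj_ofReal] at this
  exact (Complex.conj_eq_iff_re.mp this.symm)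

theorem coe_realP' (s : ℝ) : (realP' s : ℂ) = ℘'[hexPair] s := by
  have := derivWeierstrassP_conj s
  rw [Complex.conj_ofReal] at this
  exact (Complex.conj_eq_iff_re.mp this.symm)

theorem ofReal_notMem_lattice {s : ℝ} (h0 : 0 < s) (h1 : s < 1) : (s : ℂ) ∉ hexPair.lattice := by
  rw [ofReal_mem_lattice]
  rintro ⟨n, rfl⟩
  have h0' : 0 < n := by exact_mod_cast h0
  have h1' : n < 1 := by exact_mod_cast h1
  omega

theorem hasDerivAt_realP {s : ℝ} (h0 : 0 < s) (h1 : s < 1) : HasDerivAt realP (realP' s) s :=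
  (hasDerivAt_weierstrassP (ofReal_notMem_lattice h0 h1)).real_of_complex

theorem continuousAt_realP' {s : ℝ} (h0 : 0 < s) (h1 : s < 1) : ContinuousAt realP' s :=
  (hasDerivAt_derivWeierstrassP (ofReal_notMem_lattice h0 h1)).real_of_complex.continuousAt

theorem realP'_sq {s : ℝ} (h0 : 0 < s) (h1 : s < 1) :
    realP' s ^ 2 = 4 * realP s ^ 3 - 4 * realP (1 / 2) ^ 3 := by
  have h := derivWeierstrassP_sq (ofReal_notMem_lattice h0 h1)
  have e : (℘[hexPair] (1 / 2) : ℂ) = realP (1 / 2) := by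
    rw [coe_realP]; push_cast; rfl
  rw [hexPair_g₃, e, ← coe_realP, ← coe_realP'] at h
  exact_mod_cast h

theorem realP_ne_zero {s : ℝ} (h0 : 0 < s) (h1 : s < 1) : realP s ≠ 0 := by
  have := weierstrassP_ofReal_ne_zero (ofReal_notMem_lattice h0 h1)
  rw [← coe_realP] at this
  exact_mod_cast this

theorem realP'_ne_zero {s : ℝ} (h0 : 0 < s) (h1 : s < 1 / 2) : realP' s ≠ 0 := by
  intro h
  have := two_mul_mem_of_derivWeierstrassP_eq_zero
    (ofReal_notMem_lattice h0 (h1.trans (by norm_num))) (by rw [← coe_realP', h]; simp)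
  refine ofReal_notMem_lattice (s := 2 * s) (by linarith) (by linarith) ?_
  push_cast
  exact this

theorem tendsto_ofReal_nhdsGT : Tendsto (fun s : ℝ => (s : ℂ)) (𝓝[>] 0) (𝓝[≠] 0) := by
  refine tendsto_nhdsWithin_iff.mpr ⟨?_, ?_⟩
  · have : ContinuousAt (fun s : ℝ => (s : ℂ)) 0 := by fun_prop
    simpa using this.tendsto.mono_left nhdsWithin_le_nhds
  · filter_upwards [self_mem_nhdsWithin] with s hs
    simpa using (ne_of_gt hs)

theorem tendsto_sq_mul_realP : Tendsto (fun s => s ^ 2 * realP s) (𝓝[>] 0) (𝓝 1) := by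
  have h := (Complex.continuous_re.tendsto _).comp
    (tendsto_sq_mul_weierstrassP.comp tendsto_ofReal_nhdsGT)
  rw [Complex.one_re] at h
  refine h.congr fun s => ?_
  simp only [Function.comp]
  rw [← coe_realP, ← Complex.ofReal_pow, ← Complex.ofReal_mul, Complex.ofReal_re]

theorem tendsto_cube_mul_realP' : Tendsto (fun s => s ^ 3 * realP' s) (𝓝[>] 0) (𝓝 (-2)) := by
  have h := (Complex.continuous_re.tendsto _).comp
    (tendsto_cube_mul_derivWeierstrassP.comp tendsto_ofReal_nhdsGT)
  have e : (-2 : ℂ).re = -2 := by simp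
  rw [e] at h
  refine h.congr fun s => ?_
  simp only [Function.comp]
  rw [← coe_realP', ← Complex.ofReal_pow, ← Complex.ofReal_mul, Complex.ofReal_re]

theorem tendsto_realP : Tendsto realP (𝓝[>] 0) atTop := by
  have h2 : Tendsto (fun s : ℝ => (s ^ 2)⁻¹) (𝓝[>] 0) atTop := by
    refine tendsto_inv_nhdsGT_zero.comp (tendsto_nhdsWithin_iff.mpr ⟨?_, ?_⟩)
    · have : ContinuousAt (fun s : ℝ => s ^ 2) 0 := by fun_prop
      simpa using this.tendsto.mono_left nhdsWithin_le_nhds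
    · filter_upwards [self_mem_nhdsWithin] with s hs
      exact pow_pos (show 0 < s from hs) 2
  refine (h2.atTop_mul_pos one_pos tendsto_sq_mul_realP).congr' ?_
  filter_upwards [self_mem_nhdsWithin] with s hs
  rw [inv_mul_cancel_left₀ (pow_pos (show 0 < s from hs) 2).ne']

theorem pos_of_ne_zero_of_pos {f : ℝ → ℝ} {S : Set ℝ} (hS : IsPreconnected S)
    (hf : ContinuousOn f S) (h0 : ∀ s ∈ S, f s ≠ 0) {a : ℝ} (ha : a ∈ S) (hpos : 0 < f a) :
    ∀ s ∈ S, 0 < f s := by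
  intro s hs
  by_contra hneg
  obtain ⟨c, hc, hc0⟩ := hS.intermediate_value hs ha hf ⟨not_lt.mp hneg, hpos.le⟩
  exact h0 c hc hc0

theorem realP_pos {s : ℝ} (h0 : 0 < s) (h1 : s < 1) : 0 < realP s := by
  have hev := (tendsto_realP.eventually_gt_atTop 0).and (Ioo_mem_nhdsGT (zero_lt_one (α := ℝ)))
  obtain ⟨a, ha, ha'⟩ := hev.exists
  exact pos_of_ne_zero_of_pos isPreconnected_Ioo
    (fun x hx => (hasDerivAt_realP hx.1 hx.2).continuousAt.continuousWithinAt)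
    (fun x hx => realP_ne_zero hx.1 hx.2) ha' ha s ⟨h0, h1⟩

/-- Zeros of ℘' are 2-torsion, so ℘' keeps one sign on (0, 1/2); near 0 it behaves like -2/s³. -/
theorem realP'_neg {s : ℝ} (h0 : 0 < s) (h1 : s < 1 / 2) : realP' s < 0 := by
  have h2 : (-2 : ℝ) < 0 := by norm_num
  have hev := (tendsto_cube_mul_realP'.eventually_lt_const h2).and
    (Ioo_mem_nhdsGT (show (0 : ℝ) < 1 / 2 by norm_num))
  obtain ⟨a, ha, ha'⟩ := hev.exists
  have hpos : 0 < -realP' a := by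
    have := pow_pos ha'.1 3
    by_contra hcon
    nlinarith
  have := pos_of_ne_zero_of_pos (f := fun x => -realP' x) isPreconnected_Ioo
    (fun x hx => (continuousAt_realP' hx.1
      (hx.2.trans (by norm_num))).neg.continuousWithinAt)
    (fun x hx => neg_ne_zero.mpr (realP'_ne_zero hx.1 hx.2)) ha' hpos s ⟨h0, h1⟩
  linarith

theorem strictAntiOn_realP : StrictAntiOn realP (Ioc 0 (1 / 2)) := by
  refine strictAntiOn_of_deriv_neg (convex_Ioc _ _) ?_ ?_
  · exact fun x hx => (hasDerivAt_realP hx.1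
      (hx.2.trans_lt (by norm_num))).continuousAt.continuousWithinAt
  · intro x hx
    rw [interior_Ioc] at hx
    rw [(hasDerivAt_realP hx.1 (hx.2.trans (by norm_num))).deriv]
    exact realP'_neg hx.1 hx.2

theorem half_lt_realP {s : ℝ} (h0 : 0 < s) (h1 : s < 1 / 2) : realP (1 / 2) < realP s :=
  strictAntiOn_realP ⟨h0, h1.le⟩ ⟨by norm_num, le_rfl⟩ h1

/-- The substitution turning the period integral into a beta integral. -/
def betaSubst (s : ℝ) : ℝ := (realP (1 / 2) / realP s) ^ 3

theorem realP_half_pos : 0 < realP (1 / 2) := realP_pos (by norm_num) (by norm_num)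

theorem strictMonoOn_betaSubst : StrictMonoOn betaSubst (Ioo 0 (1 / 2)) := by
  intro a ha b hb hab
  have h := strictAntiOn_realP ⟨ha.1, ha.2.le⟩ ⟨hb.1, hb.2.le⟩ hab
  have hb0 := realP_pos hb.1 (hb.2.trans (by norm_num))
  have ha0 := realP_pos ha.1 (ha.2.trans (by norm_num))
  have he := realP_half_pos
  unfold betaSubst
  gcongr

theorem image_betaSubst : betaSubst '' Ioo 0 (1 / 2) = Ioo 0 1 := by
  have he := realP_half_pos
  apply Subset.antisymm
  · rintro _ ⟨s, hs, rfl⟩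
    have h0 := realP_pos hs.1 (hs.2.trans (by norm_num))
    have h1 := half_lt_realP hs.1 hs.2
    refine ⟨by unfold betaSubst; positivity, ?_⟩
    exact pow_lt_one₀ (by positivity) ((div_lt_one h0).mpr h1) (by norm_num)
  · intro y hy
    set r : ℝ := y ^ (1 / 3 : ℝ) with hr
    have hr0 : 0 < r := Real.rpow_pos_of_pos hy.1 _
    have hr3 : r ^ 3 = y := by
      rw [hr, ← Real.rpow_natCast, ← Real.rpow_mul hy.1.le]
      norm_num
    have hr1 : r < 1 := Real.rpow_lt_one hy.1.le hy.2 (by norm_num)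
    have hx : realP (1 / 2) < realP (1 / 2) / r := (lt_div_iff₀ hr0).mpr (by nlinarith)
    have hev := (tendsto_realP.eventually_gt_atTop (realP (1 / 2) / r)).and
      (Ioo_mem_nhdsGT (show (0 : ℝ) < 1 / 2 by norm_num))
    obtain ⟨a, ha, ha'⟩ := hev.exists
    have hc : ContinuousOn realP (Icc a (1 / 2)) := fun x hx =>
      (hasDerivAt_realP (ha'.1.trans_le hx.1)
        (hx.2.trans_lt (by norm_num))).continuousAt.continuousWithinAt
    obtain ⟨s, hs, hs'⟩ := intermediate_value_Ioo' ha'.2.le hc ⟨hx, ha⟩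
    refine ⟨s, ⟨ha'.1.trans hs.1, hs.2⟩, ?_⟩
    rw [betaSubst, hs', div_div_cancel₀ he.ne', hr3]

theorem hasDerivAt_betaSubst {s : ℝ} (h0 : 0 < s) (h1 : s < 1) : HasDerivAt betaSubst
    (-3 * realP (1 / 2) ^ 3 / realP s ^ 4 * realP' s) s := by
  have hp := (realP_pos h0 h1).ne'
  have h := (((hasDerivAt_realP h0 h1).inv hp).const_mul (realP (1 / 2))).pow 3
  have e : betaSubst = (fun y => realP (1 / 2) * realP⁻¹ y) ^ 3 := by
    funext y
    simp [betaSubst, div_eq_mul_inv]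
  rw [e]
  refine h.congr_deriv ?_
  simp only [Pi.inv_apply, Nat.add_one_sub_one, Nat.cast_ofNat]
  field_simp

/-- With e = ℘(1/2) and v = (e/℘)³ the cubic relation reads ℘'² = 4℘³(1 - v), so -℘' = 2℘^{3/2}(1 -
v)^{1/2} and all dependence on s cancels. This turns B(1/6, 1/2) into the integral of a constant
over (0, 1/2). -/
theorem abs_deriv_betaSubst_mul {s : ℝ} (h0 : 0 < s) (h1 : s < 1 / 2) :
    |(-3 * realP (1 / 2) ^ 3 / realP s ^ 4 * realP' s)| *
      (betaSubst s ^ (-5 / 6 : ℝ) * (1 - betaSubst s) ^ (-1 / 2 : ℝ)) =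
      6 * Real.sqrt (realP (1 / 2)) := by
  have h1' : s < 1 := h1.trans (by norm_num)
  have he := realP_half_pos
  have hh := realP_pos h0 h1'
  have hk := realP'_neg h0 h1
  have hsq := realP'_sq h0 h1'
  have hv : betaSubst s ∈ Ioo 0 1 := image_betaSubst ▸ ⟨s, ⟨h0, h1⟩, rfl⟩
  set e := realP (1 / 2)
  set h := realP s
  set k := realP' s
  have hq : 0 < e / h := div_pos he hh
  have hq0 : betaSubst s = (e / h) ^ 3 := rfl
  set v := betaSubst s
  have hk2 : -k = 2 * h * Real.sqrt h * Real.sqrt (1 - v) := by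
    have e1 : (-k) ^ 2 = (2 * h * Real.sqrt h * Real.sqrt (1 - v)) ^ 2 := by
      rw [mul_pow, mul_pow, Real.sq_sqrt hh.le, Real.sq_sqrt (by linarith [hv.2]), hq0, neg_sq, hsq]
      field_simp
      ring
    exact (pow_left_inj₀ (by linarith) (by positivity) (by norm_num)).mp e1
  have hv1 : v ^ (-5 / 6 : ℝ) = Real.sqrt (e / h) / (e / h) ^ 3 := by
    rw [hq0, ← Real.rpow_natCast, ← Real.rpow_mul hq.le, Real.sqrt_eq_rpow, ← Real.rpow_sub hq]
    norm_num
  have hv2 : (1 - v) ^ (-1 / 2 : ℝ) = (Real.sqrt (1 - v))⁻¹ := by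
    rw [Real.sqrt_eq_rpow, ← Real.rpow_neg (by linarith [hv.2])]
    norm_num
  have hs1 : 0 < Real.sqrt (1 - v) := Real.sqrt_pos.mpr (by linarith [hv.2])
  have habs : |(-3 * e ^ 3 / h ^ 4 * k)| = 3 * e ^ 3 / h ^ 4 * (-k) := by
    rw [abs_of_pos]
    · ring
    · have : 0 < 3 * e ^ 3 / h ^ 4 * (-k) := by
        have : 0 < -k := by linarith
        positivity
      linarith [this, show -3 * e ^ 3 / h ^ 4 * k = 3 * e ^ 3 / h ^ 4 * (-k) by ring]
  rw [habs, hk2, hv1, hv2, Real.sqrt_div he.le]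
  have hsh : 0 < Real.sqrt h := Real.sqrt_pos.mpr hh
  field_simp
  norm_num

theorem integral_beta : ∫ y in Ioo (0 : ℝ) 1, y ^ (-5 / 6 : ℝ) * (1 - y) ^ (-1 / 2 : ℝ) =
    3 * Real.sqrt (realP (1 / 2)) := by
  rw [← image_betaSubst, MeasureTheory.integral_image_eq_integral_abs_deriv_smul measurableSet_Ioo
    (fun s hs => (hasDerivAt_betaSubst hs.1 (hs.2.trans (by norm_num))).hasDerivWithinAt)
    strictMonoOn_betaSubst.injOn]
  rw [MeasureTheory.setIntegral_congr_fun (g := fun _ => 6 * Real.sqrt (realP (1 / 2)))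
    (f := fun s => |(-3 * realP (1 / 2) ^ 3 / realP s ^ 4 * realP' s)| •
      (betaSubst s ^ (-5 / 6 : ℝ) * (1 - betaSubst s) ^ (-1 / 2 : ℝ)))
    measurableSet_Ioo (fun s hs => abs_deriv_betaSubst_mul hs.1 hs.2)]
  simp
  ring

theorem betaIntegral_sixth_half :
    Complex.betaIntegral (1 / 6) (1 / 2) = 3 * Real.sqrt (realP (1 / 2)) := by
  have h := congrArg (fun x : ℝ => (x : ℂ)) integral_beta
  rw [← integral_complex_ofReal] at h
  push_cast at h
  rw [← h, Complex.betaIntegral, intervalIntegral.integral_of_le zero_le_one,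
    MeasureTheory.integral_Ioc_eq_integral_Ioo]
  refine MeasureTheory.setIntegral_congr_fun measurableSet_Ioo fun y hy => ?_
  rw [Complex.ofReal_cpow hy.1.le, Complex.ofReal_cpow (by linarith [hy.2])]
  push_cast
  congr 2 <;> norm_num

/-- Write both beta values through Γ and eliminate Γ(1/6), using Γ(1/3)Γ(2/3) = π/sin(π/3) and
Γ(1/2)² = π. -/
theorem sqrt_three_mul_betaIntegral :
    (Real.sqrt 3 : ℂ) * Complex.betaIntegral (1 / 3) (1 / 6) =
      2 * Complex.betaIntegral (1 / 6) (1 / 2) := by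
  have h1 := Complex.Gamma_mul_Gamma_eq_betaIntegral (s := 1 / 3) (t := 1 / 6)
    (by norm_num) (by norm_num)
  have h2 := Complex.Gamma_mul_Gamma_eq_betaIntegral (s := 1 / 6) (t := 1 / 2)
    (by norm_num) (by norm_num)
  have h3 := Complex.Gamma_mul_Gamma_one_sub (1 / 3)
  have h4 : Complex.Gamma (1 / 2) ^ 2 = Real.pi := by
    rw [Complex.Gamma_one_half_eq, ← Complex.cpow_nat_mul]
    norm_num
  have hs : Complex.sin (Real.pi * (1 / 3)) = Real.sqrt 3 / 2 := by
    rw [show (Real.pi * (1 / 3) : ℂ) = ((Real.pi / 3 : ℝ) : ℂ) by push_cast; ring,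
      ← Complex.ofReal_sin, Real.sin_pi_div_three]
    push_cast; rfl
  rw [show (1 / 3 + 1 / 6 : ℂ) = 1 / 2 by norm_num] at h1
  rw [show (1 / 6 + 1 / 2 : ℂ) = 2 / 3 by norm_num] at h2
  rw [show (1 - 1 / 3 : ℂ) = 2 / 3 by norm_num, hs] at h3
  have h30 : (Real.sqrt 3 : ℂ) ≠ 0 := by
    have : Real.sqrt 3 ≠ 0 := by positivity
    exact_mod_cast this
  have hpi : (Real.pi : ℂ) ≠ 0 := by exact_mod_cast Real.pi_ne_zero
  set B1 := Complex.betaIntegral (1 / 3) (1 / 6)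
  set B2 := Complex.betaIntegral (1 / 6) (1 / 2)
  have h5 : (Real.pi : ℂ) * B1 = Real.pi / (Real.sqrt 3 / 2) * B2 := by
    rw [← h3, ← h4]
    linear_combination (-Complex.Gamma (1 / 2)) * h1 + Complex.Gamma (1 / 3) * h2
  field_simp at h5
  linear_combination h5

/-- The two preceding relations give B(1/3, 1/6)² = 12 ℘(1/2), and g₃ = 4 ℘(1/2)³. -/
theorem betaIntegral_pow_six :
    Complex.betaIntegral (1 / 3) (1 / 6) ^ 6 = 432 * hexPair.g₃ := by
  have h := sqrt_three_mul_betaIntegral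
  rw [betaIntegral_sixth_half] at h
  have h3 : (Real.sqrt 3 : ℂ) ^ 2 = 3 := by
    rw [← Complex.ofReal_pow, Real.sq_sqrt (by norm_num)]; norm_num
  have he : (Real.sqrt (realP (1 / 2)) : ℂ) ^ 2 = ℘[hexPair] (1 / 2) := by
    rw [← Complex.ofReal_pow, Real.sq_sqrt realP_half_pos.le, coe_realP]
    push_cast; rfl
  set B := Complex.betaIntegral (1 / 3) (1 / 6)
  have h2 : B ^ 2 = 12 * ℘[hexPair] (1 / 2) := by
    have := congrArg (· ^ 2) h
    simp only [mul_pow, h3, he] at this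
    linear_combination this / 3
  rw [hexPair_g₃, show B ^ 6 = (B ^ 2) ^ 3 by ring, h2]
  ring

end

/-! ### Uniformisation of the cubic by ℂ. -/

section

open scoped PeriodPair
open Filter Topology Set

/-- The normalising constant of `ψ₁`. -/
def psiConst : ℂ := (1 - zeta ^ 2) * Complex.betaIntegral (1 / 3) (1 / 6)

theorem psiConst_pow_six : psiConst ^ 6 = -11664 * hexPair.g₃ := by
  have h : (1 - zeta ^ 2) ^ 6 = -27 := by
    have e : (1 - zeta ^ 2) ^ 2 = -3 * zeta ^ 2 := by
      linear_combination (zeta ^ 2 + zeta + 1) * zeta_sq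
    rw [show (1 - zeta ^ 2) ^ 6 = ((1 - zeta ^ 2) ^ 2) ^ 3 by ring, e]
    linear_combination -27 * (zeta ^ 3 - 1) * zeta_cube
  rw [psiConst, mul_pow, h, betaIntegral_pow_six]
  ring

theorem psiConst_ne_zero : psiConst ≠ 0 := by
  intro h
  have := psiConst_pow_six
  rw [h, hexPair_g₃] at this
  have h0 : ℘[hexPair] (1 / 2) ^ 3 = 0 := by linear_combination this / 46656
  exact weierstrassP_half_ne_zero (pow_eq_zero_iff (by norm_num) |>.mp h0)

/-- The uniformisation of the affine coordinate `X / Z`. -/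
def xF (z : ℂ) : ℂ := 36 / psiConst ^ 2 * ℘[hexPair] z

/-- The uniformisation of the affine coordinate `W / Z`. -/
def wF (z : ℂ) : ℂ := -108 / psiConst ^ 3 * ℘'[hexPair] z

/-- The uniformisation of the coordinate `X / W`. -/
def aF (z : ℂ) : ℂ := xF z / wF z

/-- The uniformisation of the coordinate `Z / W`. -/
def bF (z : ℂ) : ℂ := 1 / wF z

/-- The ratio 108²/36³ = 1/4 matches the leading coefficients, and K⁶ = -11664 g₃ makes the constant
term equal to 1. -/
theorem wF_sq {z : ℂ} (hz : z ∉ hexPair.lattice) : wF z ^ 2 = xF z ^ 3 + 1 := by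
  have hK := psiConst_ne_zero
  have h6 := psiConst_pow_six
  have h := derivWeierstrassP_sq hz
  unfold wF xF
  rw [mul_pow, mul_pow, h]
  field_simp
  linear_combination -h6

theorem wF_eq_zero_iff {z : ℂ} : wF z = 0 ↔ ℘'[hexPair] z = 0 := by
  have hK := psiConst_ne_zero
  simp [wF, hK]

theorem hasDerivAt_xF {z : ℂ} (hz : z ∉ hexPair.lattice) :
    HasDerivAt xF (-(psiConst / 3) * wF z) z := by
  have hK := psiConst_ne_zero
  refine ((hasDerivAt_weierstrassP hz).const_mul _).congr_deriv ?_
  unfold wF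
  field_simp
  ring

theorem hasDerivAt_wF {z : ℂ} (hz : z ∉ hexPair.lattice) :
    HasDerivAt wF (-(psiConst / 2) * xF z ^ 2) z := by
  have hK := psiConst_ne_zero
  refine ((hasDerivAt_derivWeierstrassP hz).const_mul _).congr_deriv ?_
  unfold xF
  field_simp
  ring

theorem xF_add_mem (z : ℂ) {l : ℂ} (hl : l ∈ hexPair.lattice) : xF (z + l) = xF z := by
  rw [xF, weierstrassP_add_mem z hl, xF]

theorem wF_add_mem (z : ℂ) {l : ℂ} (hl : l ∈ hexPair.lattice) : wF (z + l) = wF z := by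
  rw [wF, derivWeierstrassP_add_mem z hl, wF]

theorem aF_add_mem (z : ℂ) {l : ℂ} (hl : l ∈ hexPair.lattice) : aF (z + l) = aF z := by
  rw [aF, xF_add_mem z hl, wF_add_mem z hl, aF]

theorem bF_add_mem (z : ℂ) {l : ℂ} (hl : l ∈ hexPair.lattice) : bF (z + l) = bF z := by
  rw [bF, wF_add_mem z hl, bF]

/-- A default value at a pole. Through division by zero it gives `aF` and `bF` the value 0 there,
which are the true coordinates X/W and Z/W of P₁, so these two functions are differentiable at
lattice points. -/
theorem wF_of_mem {z : ℂ} (hz : z ∈ hexPair.lattice) : wF z = 0 :=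
  wF_eq_zero_iff.mpr (hexPair.derivWeierstrassP_coe ⟨z, hz⟩)

theorem aF_of_mem {z : ℂ} (hz : z ∈ hexPair.lattice) : aF z = 0 := by
  rw [aF, wF_of_mem hz, div_zero]

theorem bF_of_mem {z : ℂ} (hz : z ∈ hexPair.lattice) : bF z = 0 := by
  rw [bF, wF_of_mem hz, div_zero]

theorem hasDerivAt_aF_zero : HasDerivAt aF (psiConst / 6) 0 := by
  have hK := psiConst_ne_zero
  rw [hasDerivAt_iff_tendsto_slope_zero]
  have h := (tendsto_sq_mul_weierstrassP.div tendsto_cube_mul_derivWeierstrassP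
    (by norm_num)).const_mul (-(psiConst / 3))
  -- The difference quotient of `aF` at 0 is -(K/3) · t²℘ / (t³℘'), with limits 1 and -2 above and
  -- below.
  rw [show -(psiConst / 3) * (1 / -2) = psiConst / 6 by ring] at h
  refine h.congr' ?_
  filter_upwards [self_mem_nhdsWithin] with t ht
  have ht' : t ≠ 0 := ht
  rw [zero_add, aF_of_mem hexPair.lattice.zero_mem, sub_zero, smul_eq_mul, aF, xF, wF, Pi.div_apply]
  by_cases h0 : ℘'[hexPair] t = 0
  · simp [h0]
  · field_simp
    ring

theorem hasDerivAt_bF_zero : HasDerivAt bF 0 0 := by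
  have hK := psiConst_ne_zero
  rw [hasDerivAt_iff_tendsto_slope_zero]
  have h2 : Tendsto (fun t : ℂ => t ^ 2) (𝓝[≠] 0) (𝓝 0) := by
    have : ContinuousAt (fun t : ℂ => t ^ 2) 0 := by fun_prop
    simpa using this.tendsto.mono_left nhdsWithin_le_nhds
  have h := (h2.div tendsto_cube_mul_derivWeierstrassP
    (by norm_num)).const_mul (-(psiConst ^ 3 / 108))
  rw [show -(psiConst ^ 3 / 108) * (0 / -2) = 0 by ring] at h
  refine h.congr' ?_
  filter_upwards [self_mem_nhdsWithin] with t ht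
  have ht' : t ≠ 0 := ht
  rw [zero_add, bF_of_mem hexPair.lattice.zero_mem, sub_zero, smul_eq_mul, bF, wF, Pi.div_apply]
  by_cases h0 : ℘'[hexPair] t = 0
  · simp [h0]
  · field_simp

theorem hasDerivAt_aF {z : ℂ} (hz : z ∈ hexPair.lattice ∨ wF z ≠ 0) :
    HasDerivAt aF (psiConst / 6 * (1 - 3 * bF z ^ 2)) z := by
  by_cases hzL : z ∈ hexPair.lattice
  · have e : aF = fun w => aF (w - z) := by
      funext w
      rw [sub_eq_add_neg, aF_add_mem w (hexPair.lattice.neg_mem hzL)]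
    have h : HasDerivAt aF (psiConst / 6) (z - z) := by
      rw [sub_self]; exact hasDerivAt_aF_zero
    rw [bF_of_mem hzL, e]
    simpa using h.comp_sub_const z z
  · have hw := hz.resolve_left hzL
    refine ((hasDerivAt_xF hzL).div (hasDerivAt_wF hzL) hw).congr_deriv ?_
    have := wF_sq hzL
    unfold bF
    field_simp
    linear_combination -18 * psiConst * this

theorem hasDerivAt_bF {z : ℂ} (hz : z ∈ hexPair.lattice ∨ wF z ≠ 0) :
    HasDerivAt bF (psiConst / 2 * aF z ^ 2) z := by
  by_cases hzL : z ∈ hexPair.lattice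
  · have e : bF = fun w => bF (w - z) := by
      funext w
      rw [sub_eq_add_neg, bF_add_mem w (hexPair.lattice.neg_mem hzL)]
    have h : HasDerivAt bF 0 (z - z) := by
      rw [sub_self]; exact hasDerivAt_bF_zero
    rw [aF_of_mem hzL, e]
    simpa using h.comp_sub_const z z
  · have hw := hz.resolve_left hzL
    have h := (hasDerivAt_wF hzL).inv hw
    have e : bF = wF⁻¹ := by
      funext w
      simp [bF]
    rw [e]
    refine h.congr_deriv ?_
    unfold aF
    field_simp

theorem eventually_mem_or_wF_ne_zero {z : ℂ} (hz : z ∈ hexPair.lattice) :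
    ∀ᶠ u in 𝓝 z, u ∈ hexPair.lattice ∨ wF u ≠ 0 := by
  have h0 : ∀ᶠ u in 𝓝 (0 : ℂ), u ∈ hexPair.lattice ∨ wF u ≠ 0 := by
    have h2 : (-2 : ℂ) ≠ 0 := by norm_num
    have := eventually_nhdsWithin_iff.mp (tendsto_cube_mul_derivWeierstrassP.eventually_ne h2)
    filter_upwards [this] with u hu
    by_cases hu0 : u = 0
    · exact Or.inl (hu0 ▸ hexPair.lattice.zero_mem)
    · exact Or.inr fun h => hu hu0 (by rw [wF_eq_zero_iff.mp h, mul_zero])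
  have hc : Tendsto (fun u => u - z) (𝓝 z) (𝓝 0) := by
    have : ContinuousAt (fun u => u - z) z := by fun_prop
    simpa using this.tendsto
  filter_upwards [hc.eventually h0] with u hu
  rcases hu with hu | hu
  · exact Or.inl (by simpa using hexPair.lattice.add_mem hu hz)
  · refine Or.inr ?_
    rwa [sub_eq_add_neg, wF_add_mem u (hexPair.lattice.neg_mem hz)] at hu

/-- The homogeneous vector `p` represents the image of `z` under the uniformisation. -/
def Rep (z : ℂ) (p : Fin 3 → ℂ) : Prop :=
  (z ∈ hexPair.lattice ∧ p 0 = 0 ∧ p 2 = 0) ∨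
    (z ∉ hexPair.lattice ∧ p 0 = xF z * p 2 ∧ p 1 = wF z * p 2)

theorem Rep.add_mem {z : ℂ} {p : Fin 3 → ℂ} (h : Rep z p) {l : ℂ} (hl : l ∈ hexPair.lattice) :
    Rep (z + l) p := by
  unfold Rep at *
  rw [hexPair.lattice.add_mem_iff_left hl, xF_add_mem z hl, wF_add_mem z hl]
  exact h

theorem Rep.smul {z : ℂ} {p : Fin 3 → ℂ} (h : Rep z p) (a : ℂ) : Rep z (a • p) := by
  rcases h with ⟨hz, h0, h2⟩ | ⟨hz, h0, h1⟩
  · exact Or.inl ⟨hz, by simp [h0], by simp [h2]⟩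
  · refine Or.inr ⟨hz, ?_, ?_⟩
    · simp only [Pi.smul_apply, smul_eq_mul, h0]; ring
    · simp only [Pi.smul_apply, smul_eq_mul, h1]; ring

theorem Rep.onCubic {z : ℂ} {p : Fin 3 → ℂ} (h : Rep z p) : OnCubic p := by
  unfold OnCubic
  rcases h with ⟨hz, h0, h2⟩ | ⟨hz, h0, h1⟩
  · rw [h0, h2]; ring
  · rw [h0, h1]
    linear_combination p 2 ^ 3 * wF_sq hz

theorem Rep.ne_zero_two {z : ℂ} {p : Fin 3 → ℂ} (h : Rep z p) (hp : p ≠ 0)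
    (hz : z ∉ hexPair.lattice) : p 2 ≠ 0 := by
  intro h2
  rcases h with ⟨hz', -⟩ | ⟨-, h0, h1⟩
  · exact hz hz'
  · apply hp
    ext i
    fin_cases i
    · simpa [h2] using h0
    · simpa [h2] using h1
    · exact h2

theorem Rep.ne_zero_one {z : ℂ} {p : Fin 3 → ℂ} (h : Rep z p) (hp : p ≠ 0)
    (hz : z ∈ hexPair.lattice) : p 1 ≠ 0 := by
  intro h1
  rcases h with ⟨-, h0, h2⟩ | ⟨hz', -⟩
  · apply hp
    ext i
    fin_cases i
    · exact h0
    · exact h1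
    · exact h2
  · exact hz' hz

theorem Rep.chart {z : ℂ} {p : Fin 3 → ℂ} (h : Rep z p)
    (hz : z ∈ hexPair.lattice ∨ wF z ≠ 0) : p 0 = aF z * p 1 ∧ p 2 = bF z * p 1 := by
  rcases h with ⟨hz, h0, h2⟩ | ⟨hzL, h0, h1⟩
  · rw [aF_of_mem hz, bF_of_mem hz, h0, h2]; simp
  · have hw := hz.resolve_left hzL
    rw [h0, h1, aF, bF]
    constructor <;> field_simp

theorem rep_of_chart {z : ℂ} {p : Fin 3 → ℂ} (hz : z ∈ hexPair.lattice ∨ wF z ≠ 0)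
    (h0 : p 0 = aF z * p 1) (h2 : p 2 = bF z * p 1) : Rep z p := by
  by_cases hzL : z ∈ hexPair.lattice
  · rw [aF_of_mem hzL, zero_mul] at h0
    rw [bF_of_mem hzL, zero_mul] at h2
    exact Or.inl ⟨hzL, h0, h2⟩
  · have hw := hz.resolve_left hzL
    refine Or.inr ⟨hzL, ?_, ?_⟩
    · rw [h0, h2, aF, bF]; field_simp
    · rw [h2, bF]; field_simp

/-- Surjectivity of the uniformisation. If Z = 0 then X = 0 and z = 0 works; otherwise X/Z and W/Z
are rescaled to a point of y² = 4x³ - g₃. -/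
theorem exists_rep {p : Fin 3 → ℂ} (hp : OnCubic p) : ∃ z, Rep z p := by
  have hK := psiConst_ne_zero
  unfold OnCubic at hp
  by_cases h2 : p 2 = 0
  · refine ⟨0, Or.inl ⟨hexPair.lattice.zero_mem, ?_, h2⟩⟩
    have : p 0 ^ 3 = 0 := by rw [h2] at hp; linear_combination -hp
    exact pow_eq_zero_iff (by norm_num) |>.mp this
  · obtain ⟨z, hz, hx, hy⟩ := exists_weierstrassP_eq_and
      (x := psiConst ^ 2 / 36 * (p 0 / p 2)) (y := -(psiConst ^ 3 / 108) * (p 1 / p 2)) (by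
        have hg : hexPair.g₃ = -(psiConst ^ 6 / 11664) := by
          linear_combination (1 / 11664 : ℂ) * psiConst_pow_six
        rw [hg]
        field_simp
        linear_combination 544195584 * hp)
    refine ⟨z, Or.inr ⟨hz, ?_, ?_⟩⟩
    · rw [xF, hx]; field_simp
    · rw [wF, hy]; field_simp

/-- The source of path independence: two parameters of one point differ by a period, by injectivity
of (℘, ℘') on the torus. -/
theorem Rep.sub_mem {z w : ℂ} {p : Fin 3 → ℂ} (hp : p ≠ 0) (hz : Rep z p) (hw : Rep w p) :
    w - z ∈ hexPair.lattice := by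
  have hK := psiConst_ne_zero
  by_cases hzL : z ∈ hexPair.lattice
  · by_cases hwL : w ∈ hexPair.lattice
    · exact hexPair.lattice.sub_mem hwL hzL
    · rcases hz with ⟨_, _, h2⟩ | ⟨h, _⟩
      · exact absurd h2 (hw.ne_zero_two hp hwL)
      · exact absurd hzL h
  · have h2 := hz.ne_zero_two hp hzL
    rcases hz with ⟨h, _⟩ | ⟨_, h0, h1⟩
    · exact absurd h hzL
    rcases hw with ⟨_, _, h⟩ | ⟨hwL, h0', h1'⟩
    · exact absurd h h2
    have hx : xF z = xF w := mul_right_cancel₀ h2 (h0.symm.trans h0')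
    have hy : wF z = wF w := mul_right_cancel₀ h2 (h1.symm.trans h1')
    refine sub_mem_of_weierstrassP_eq hzL hwL ?_ ?_
    · exact mul_left_cancel₀ (div_ne_zero (by norm_num) (pow_ne_zero 2 hK)) hx
    · exact mul_left_cancel₀ (div_ne_zero (by norm_num) (pow_ne_zero 3 hK)) hy

theorem Rep.mk_eq {z : ℂ} {p q : Fin 3 → ℂ} (hp : Rep z p) (hq : Rep z q) (hp0 : p ≠ 0)
    (hq0 : q ≠ 0) : Projectivization.mk ℂ p hp0 = Projectivization.mk ℂ q hq0 := by
  rw [Projectivization.mk_eq_mk_iff']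
  by_cases hzL : z ∈ hexPair.lattice
  · have h1 := hq.ne_zero_one hq0 hzL
    rcases hp with ⟨_, h0, h2⟩ | ⟨h, _⟩
    · rcases hq with ⟨_, h0', h2'⟩ | ⟨h, _⟩
      · refine ⟨p 1 / q 1, ?_⟩
        ext i
        fin_cases i
        · simp [h0, h0']
        · simp [h1]
        · simp [h2, h2']
      · exact absurd hzL h
    · exact absurd hzL h
  · have h2 := hq.ne_zero_two hq0 hzL
    rcases hp with ⟨h, _⟩ | ⟨_, h0, h1⟩
    · exact absurd h hzL
    · rcases hq with ⟨h, _⟩ | ⟨_, h0', h1'⟩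
      · exact absurd h hzL
      · refine ⟨p 2 / q 2, ?_⟩
        ext i
        fin_cases i
        · simp [h0, h0']; field_simp
        · simp [h1, h1']; field_simp
        · simp [h2]

end

/-! ### Curves on the cone over the cubic and their differential equations. -/

section

open scoped PeriodPair
open Filter Topology Set

/-- Uniqueness for the solutions of `y' = θ(t) V(y)`. -/
theorem eqOn_of_ode {E : Type*} [NormedAddCommGroup E] [NormedSpace ℂ E] [ProperSpace E]
    [NormedSpace ℝ E] [IsScalarTower ℝ ℂ E]
    {V : E → E} (hV : ContDiff ℝ 1 V) {θ : ℝ → ℂ} {a b : ℝ} (hθ : ContinuousOn θ (Icc a b))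
    {f g : ℝ → E} (hf : ContinuousOn f (Icc a b)) (hg : ContinuousOn g (Icc a b))
    (hf' : ∀ t ∈ Ico a b, HasDerivWithinAt f (θ t • V (f t)) (Ici t) t)
    (hg' : ∀ t ∈ Ico a b, HasDerivWithinAt g (θ t • V (g t)) (Ici t) t)
    (h : f a = g a) : EqOn f g (Icc a b) := by
  -- The field V is only locally Lipschitz, so the uniqueness theorem is applied on the compact set
  -- swept out by both solutions.
  set S : Set E := f '' Icc a b ∪ g '' Icc a b
  have hS : IsCompact S := (isCompact_Icc.image_of_continuousOn hf).union
    (isCompact_Icc.image_of_continuousOn hg)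
  obtain ⟨K, hK⟩ := LocallyLipschitzOn.exists_lipschitzOnWith_of_compact hS
    (hV.locallyLipschitz.locallyLipschitzOn)
  obtain ⟨M, hM⟩ := isCompact_Icc.exists_bound_of_continuousOn hθ
  refine ODE_solution_unique_of_mem_Icc_right (v := fun t y => θ t • V y) (s := fun _ => S)
    (K := M.toNNReal * K) ?_ hf hf' ?_ hg hg' ?_ h
  · intro t ht
    have hMt := hM t (Ico_subset_Icc_self ht)
    refine LipschitzOnWith.of_dist_le_mul fun x hx y hy => ?_
    rw [dist_smul₀, NNReal.coe_mul, mul_assoc]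
    refine mul_le_mul (hMt.trans (Real.le_coe_toNNReal M)) (hK.dist_le_mul x hx y hy) dist_nonneg
      (NNReal.coe_nonneg _)
  · exact fun t ht => Or.inl ⟨t, Ico_subset_Icc_self ht, rfl⟩
  · exact fun t ht => Or.inr ⟨t, Ico_subset_Icc_self ht, rfl⟩

theorem isTangent_of_hasDerivWithinAt {c : ℝ → Fin 3 → ℂ} {v : Fin 3 → ℂ} {s : ℝ}
    (hs : s ∈ Icc (0 : ℝ) 1) (hc : HasDerivWithinAt c v (Icc 0 1) s)
    (h : ∀ r ∈ Icc (0 : ℝ) 1, OnCubic (c r)) : IsTangent (c s) v := by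
  have h0 := hasDerivWithinAt_pi.mp hc 0
  have h1 := hasDerivWithinAt_pi.mp hc 1
  have h2 := hasDerivWithinAt_pi.mp hc 2
  have hF := (((h1.fun_pow 2).fun_mul h2).fun_sub (h0.fun_pow 3)).fun_sub (h2.fun_pow 3)
  have hz : HasDerivWithinAt (fun r => c r 1 ^ 2 * c r 2 - c r 0 ^ 3 - c r 2 ^ 3) 0
      (Icc 0 1) s := by
    refine (hasDerivWithinAt_const s (Icc 0 1) (0 : ℂ)).congr_of_mem (fun r hr => ?_) hs
    have := h r hr
    unfold OnCubic at this
    linear_combination this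
  have := (uniqueDiffOn_Icc zero_lt_one s hs).eq_deriv _ hF hz
  simp only [IsTangent, gradF]
  simp at this ⊢
  linear_combination this

/-- A continuously differentiable curve on the cone over the cubic. -/
structure IsConeCurve (c : ℝ → Fin 3 → ℂ) : Prop where
  contDiffOn : ContDiffOn ℝ 1 c (Icc 0 1)
  ne_zero : ∀ s ∈ Icc (0 : ℝ) 1, c s ≠ 0
  onCubic : ∀ s ∈ Icc (0 : ℝ) 1, OnCubic (c s)

/-- The integrand of the line integral of `ψ` along a curve. -/
def psiSpeed (c : ℝ → Fin 3 → ℂ) (s : ℝ) : ℂ := psi (c s) (derivWithin c (Icc 0 1) s)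

namespace IsConeCurve

variable {c : ℝ → Fin 3 → ℂ} (hc : IsConeCurve c)
include hc

theorem hasDerivWithinAt {s : ℝ} (hs : s ∈ Icc (0 : ℝ) 1) :
    HasDerivWithinAt c (derivWithin c (Icc 0 1) s) (Icc 0 1) s :=
  ((hc.contDiffOn.differentiableOn (by norm_num)) s hs).hasDerivWithinAt

theorem psi_mul {s : ℝ} (hs : s ∈ Icc (0 : ℝ) 1) :
    psiSpeed c s * gradF (c s) 0 = -6 * (c s 1 * derivWithin c (Icc 0 1) s 2 -
      c s 2 * derivWithin c (Icc 0 1) s 1) ∧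
    psiSpeed c s * gradF (c s) 1 = -6 * (c s 2 * derivWithin c (Icc 0 1) s 0 -
      c s 0 * derivWithin c (Icc 0 1) s 2) ∧
    psiSpeed c s * gradF (c s) 2 = -6 * (c s 0 * derivWithin c (Icc 0 1) s 1 -
      c s 1 * derivWithin c (Icc 0 1) s 0) :=
  psi_mul_gradF (hc.ne_zero s hs) (hc.onCubic s hs)
    (isTangent_of_hasDerivWithinAt hs (hc.hasDerivWithinAt hs) hc.onCubic)

theorem continuousOn_coord (i : Fin 3) : ContinuousOn (fun s => c s i) (Icc 0 1) :=
  (continuous_apply i).comp_continuousOn hc.contDiffOn.continuousOn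

/-- The case split in `psi` hides continuity. Near each parameter some component of grad F is
non-zero, and there the matching one of the three formulas holds as a continuous quotient. -/
theorem continuousOn_psiSpeed : ContinuousOn (psiSpeed c) (Icc 0 1) := by
  have h0 := hc.continuousOn_coord 0
  have h1 := hc.continuousOn_coord 1
  have h2 := hc.continuousOn_coord 2
  have hd := hc.contDiffOn.continuousOn_derivWithin (uniqueDiffOn_Icc zero_lt_one) le_rfl
  have d0 := (continuous_apply (0 : Fin 3)).comp_continuousOn hd
  have d1 := (continuous_apply (1 : Fin 3)).comp_continuousOn hd
  have d2 := (continuous_apply (2 : Fin 3)).comp_continuousOn hd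
  simp only [Function.comp_def] at d0 d1 d2
  have key : ∀ (N g : ℝ → ℂ), ContinuousOn N (Icc 0 1) → ContinuousOn g (Icc 0 1) →
      (∀ s ∈ Icc (0 : ℝ) 1, psiSpeed c s * g s = N s) → ∀ s ∈ Icc (0 : ℝ) 1, g s ≠ 0 →
      ContinuousWithinAt (psiSpeed c) (Icc 0 1) s := by
    intro N g hN hg hm s hs hgs
    refine ((hN s hs).div (hg s hs) hgs).congr_of_eventuallyEq ?_ ?_
    · filter_upwards [(hg s hs).eventually_ne hgs, self_mem_nhdsWithin] with r hr hr'
      exact (eq_div_iff hr).mpr (hm r hr')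
    · exact (eq_div_iff hgs).mpr (hm s hs)
  intro s hs
  obtain ⟨i, hi⟩ := Function.ne_iff.mp (gradF_ne_zero (hc.ne_zero s hs))
  fin_cases i
  · refine key _ (fun r => gradF (c r) 0) ?_ ?_ (fun r hr => (hc.psi_mul hr).1) s hs hi
    · fun_prop
    · simp only [gradF, Matrix.cons_val]; fun_prop
  · refine key _ (fun r => gradF (c r) 1) ?_ ?_ (fun r hr => (hc.psi_mul hr).2.1) s hs hi
    · fun_prop
    · simp only [gradF, Matrix.cons_val]; fun_prop
  · refine key _ (fun r => gradF (c r) 2) ?_ ?_ (fun r hr => (hc.psi_mul hr).2.2) s hs hi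
    · fun_prop
    · simp only [gradF, Matrix.cons_val]; fun_prop

/-- From ψ = -3 dx/w and 2w dw = 3x² dx: the vector field dual to ψ is (-w/3, -x²/2), and the curve
moves along it with speed `psiSpeed`. -/
theorem hasDerivWithinAt_chartZ {s : ℝ} (hs : s ∈ Icc (0 : ℝ) 1) (h2 : c s 2 ≠ 0) :
    HasDerivWithinAt (fun r => (c r 0 / c r 2, c r 1 / c r 2))
      (psiSpeed c s • (-(c s 1 / c s 2) / 3, -(c s 0 / c s 2) ^ 2 / 2)) (Icc 0 1) s := by
  have d := hasDerivWithinAt_pi.mp (hc.hasDerivWithinAt hs)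
  obtain ⟨m0, m1, m2⟩ := hc.psi_mul hs
  simp only [gradF, Matrix.cons_val] at m0 m1 m2
  have e0 := (d 0).fun_div (d 2) h2
  have e1 := (d 1).fun_div (d 2) h2
  refine (e0.prodMk e1).congr_deriv ?_
  ext
  · simp only [Prod.smul_fst, smul_eq_mul]
    field_simp
    linear_combination (1 / 2 : ℂ) * m1
  · simp only [Prod.smul_snd, smul_eq_mul]
    field_simp
    linear_combination (-1 / 3 : ℂ) * m0

/-- The same dual vector field in the chart W ≠ 0, which contains P₁. -/
theorem hasDerivWithinAt_chartW {s : ℝ} (hs : s ∈ Icc (0 : ℝ) 1) (h1 : c s 1 ≠ 0) :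
    HasDerivWithinAt (fun r => (c r 0 / c r 1, c r 2 / c r 1))
      (psiSpeed c s • ((1 - 3 * (c s 2 / c s 1) ^ 2) / 6, (c s 0 / c s 1) ^ 2 / 2))
      (Icc 0 1) s := by
  have d := hasDerivWithinAt_pi.mp (hc.hasDerivWithinAt hs)
  obtain ⟨m0, m1, m2⟩ := hc.psi_mul hs
  simp only [gradF, Matrix.cons_val] at m0 m1 m2
  have e0 := (d 0).fun_div (d 1) h1
  have e1 := (d 2).fun_div (d 1) h1
  refine (e0.prodMk e1).congr_deriv ?_
  ext
  · simp only [Prod.smul_fst, smul_eq_mul]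
    field_simp
    linear_combination -m2
  · simp only [Prod.smul_snd, smul_eq_mul]
    field_simp
    linear_combination (1 / 3 : ℂ) * m0

end IsConeCurve

end

/-! ### Lifting curves to the universal cover. -/

section

open scoped PeriodPair
open Filter Topology Set

/-- The lift of a curve on the cubic to the universal cover. -/
def liftG (c : ℝ → Fin 3 → ℂ) (s : ℝ) : ℂ :=
  (∫ r in (0 : ℝ)..s, psiSpeed c (projIcc (0 : ℝ) 1 zero_le_one r)) / psiConst

theorem liftG_one (c : ℝ → Fin 3 → ℂ) : liftG c 1 = integralPsi1 c := by
  unfold liftG integralPsi1 psiConst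
  congr 1
  refine intervalIntegral.integral_congr fun r hr => ?_
  rw [uIcc_of_le zero_le_one] at hr
  simp only [projIcc_of_mem zero_le_one hr]
  rfl

theorem contDiff_chartZ_field :
    ContDiff ℝ 1 (fun y : ℂ × ℂ => ((-y.2 / 3, -y.1 ^ 2 / 2) : ℂ × ℂ)) := by
  fun_prop

theorem contDiff_chartW_field :
    ContDiff ℝ 1 (fun y : ℂ × ℂ => (((1 - 3 * y.2 ^ 2) / 6, y.1 ^ 2 / 2) : ℂ × ℂ)) := by
  fun_prop

/-- A property that holds near `s` within `[0, 1]` holds on some `[s, b]`. -/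
theorem exists_Icc_of_eventually {p : ℝ → Prop} {s : ℝ} (hs : s ∈ Ico (0 : ℝ) 1)
    (h : ∀ᶠ r in 𝓝[Icc 0 1] s, p r) : ∃ b ∈ Ioc s 1, ∀ r ∈ Icc s b, p r := by
  have h' : {r | p r} ∈ 𝓝[≥] s := by
    refine nhdsWithin_le_of_mem ?_ h
    rw [← nhdsWithin_Icc_eq_nhdsGE hs.2]
    filter_upwards [self_mem_nhdsWithin] with r hr using ⟨hs.1.trans hr.1, hr.2⟩
  obtain ⟨b, hb, hsub⟩ := (mem_nhdsGE_iff_exists_mem_Ioc_Ico_subset hs.2).mp h'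
  -- The filter only provides a half-open interval [s, b); halving its length yields a closed one.
  refine ⟨(s + b) / 2, ⟨by linarith [hb.1], by linarith [hb.1, hb.2]⟩, fun r hr => ?_⟩
  exact hsub ⟨hr.1, by linarith [hr.2, hb.1]⟩

namespace IsConeCurve

variable {c : ℝ → Fin 3 → ℂ} (hc : IsConeCurve c)
include hc

/-- The projection to [0, 1] in the integrand makes it continuous on all of ℝ, so the derivative is
two-sided even at the endpoints. -/
theorem hasDerivAt_liftG {s : ℝ} (hs : s ∈ Icc (0 : ℝ) 1) :
    HasDerivAt (liftG c) (psiSpeed c s / psiConst) s := by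
  have hcont : Continuous fun r => psiSpeed c (projIcc (0 : ℝ) 1 zero_le_one r) :=
    hc.continuousOn_psiSpeed.comp_continuous (continuous_projIcc.subtype_val)
      fun r => (projIcc (0 : ℝ) 1 zero_le_one r).2
  have h := (hcont.integral_hasStrictDerivAt 0 s).hasDerivAt.div_const psiConst
  rwa [projIcc_of_mem zero_le_one hs] at h

theorem continuousOn_liftG : ContinuousOn (liftG c) (Icc 0 1) := fun _ hs =>
  (hc.hasDerivAt_liftG hs).continuousAt.continuousWithinAt

/-- In a chart around the limit parameter, `Rep` is an equality of continuous functions and so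
passes to limits: X/W, Z/W at a period, X/Z, W/Z elsewhere. -/
theorem isClosed_rep : IsClosed ({s | Rep (liftG c s) (c s)} ∩ Icc 0 1) := by
  rw [← closure_subset_iff_isClosed]
  intro s hs
  have hsI : s ∈ Icc (0 : ℝ) 1 :=
    closure_minimal inter_subset_right isClosed_Icc hs
  refine ⟨?_, hsI⟩
  set T := {s | Rep (liftG c s) (c s)} ∩ Icc 0 1
  have hTI : T ⊆ Icc 0 1 := inter_subset_right
  have : (𝓝[T] s).NeBot := mem_closure_iff_nhdsWithin_neBot.mp hs
  have hG : Tendsto (liftG c) (𝓝[T] s) (𝓝 (liftG c s)) :=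
    (hc.hasDerivAt_liftG hsI).continuousAt.continuousWithinAt
  have hcc : ∀ i, Tendsto (fun r => c r i) (𝓝[T] s) (𝓝 (c s i)) := fun i =>
    ((hc.continuousOn_coord i) s hsI).mono hTI
  have hev : ∀ᶠ r in 𝓝[T] s, Rep (liftG c r) (c r) := by
    filter_upwards [self_mem_nhdsWithin] with r hr using hr.1
  by_cases hz : liftG c s ∈ hexPair.lattice
  · have hev2 := hG.eventually (eventually_mem_or_wF_ne_zero hz)
    have ha := ((hasDerivAt_aF (Or.inl hz)).continuousAt.tendsto.comp hG).mul (hcc 1)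
    have hb := ((hasDerivAt_bF (Or.inl hz)).continuousAt.tendsto.comp hG).mul (hcc 1)
    refine rep_of_chart (Or.inl hz) (tendsto_nhds_unique (hcc 0) (ha.congr' ?_))
      (tendsto_nhds_unique (hcc 2) (hb.congr' ?_))
    · filter_upwards [hev, hev2] with r hr hr2 using (hr.chart hr2).1.symm
    · filter_upwards [hev, hev2] with r hr hr2 using (hr.chart hr2).2.symm
  · have hev2 := hG.eventually (isOpen_compl_hexLattice.mem_nhds hz)
    have hx := ((hasDerivAt_xF hz).continuousAt.tendsto.comp hG).mul (hcc 2)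
    have hw := ((hasDerivAt_wF hz).continuousAt.tendsto.comp hG).mul (hcc 2)
    refine Or.inr ⟨hz, tendsto_nhds_unique (hcc 0) (hx.congr' ?_),
      tendsto_nhds_unique (hcc 1) (hw.congr' ?_)⟩
    · filter_upwards [hev, hev2] with r hr hr2
      rcases hr with ⟨h, -⟩ | ⟨-, h, -⟩
      · exact absurd h hr2
      · exact h.symm
    · filter_upwards [hev, hev2] with r hr hr2
      rcases hr with ⟨h, -⟩ | ⟨-, -, h⟩
      · exact absurd h hr2
      · exact h.symm

/-- The curve and the uniformised lift solve the same first-order system in a chart, because the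
uniformisation has derivative K times the vector field dual to ψ and the lift has derivative
`psiSpeed`/K. Agreement at s then propagates to the right by uniqueness. -/
theorem rep_nhdsGT {s : ℝ} (hs : s ∈ Ico (0 : ℝ) 1) (h : Rep (liftG c s) (c s)) :
    {r | Rep (liftG c r) (c r)} ∈ 𝓝[>] s := by
  have hK := psiConst_ne_zero
  have hsI : s ∈ Icc (0 : ℝ) 1 := Ico_subset_Icc_self hs
  have hG : Tendsto (liftG c) (𝓝[Icc 0 1] s) (𝓝 (liftG c s)) := hc.continuousOn_liftG s hsI
  have hsub : ∀ {b t : ℝ}, b ∈ Ioc s 1 → t ∈ Icc s b → t ∈ Icc (0 : ℝ) 1 := fun hb ht =>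
    ⟨hs.1.trans ht.1, ht.2.trans hb.2⟩
  have hmem : ∀ {b t : ℝ}, b ∈ Ioc s 1 → t ∈ Ico s b → Icc (0 : ℝ) 1 ∈ 𝓝[≥] t := by
    intro b t hb ht
    have ht1 : t < 1 := ht.2.trans_le hb.2
    rw [← nhdsWithin_Icc_eq_nhdsGE ht1]
    filter_upwards [self_mem_nhdsWithin] with r hr using ⟨(hs.1.trans ht.1).trans hr.1, hr.2⟩
  by_cases hz : liftG c s ∈ hexPair.lattice
  · have h1 := h.ne_zero_one (hc.ne_zero s hsI) hz
    have hev := (((hc.continuousOn_coord 1) s hsI).eventually_ne h1).and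
      (hG.eventually (eventually_mem_or_wF_ne_zero hz))
    obtain ⟨b, hb, hbp⟩ := exists_Icc_of_eventually hs hev
    have heq := eqOn_of_ode contDiff_chartW_field (θ := psiSpeed c)
      (hc.continuousOn_psiSpeed.mono fun t ht => hsub hb ht)
      (f := fun r => (c r 0 / c r 1, c r 2 / c r 1))
      (g := fun r => (aF (liftG c r), bF (liftG c r)))
      (fun t ht => ((hc.hasDerivWithinAt_chartW (hsub hb ht) (hbp t ht).1).continuousWithinAt.mono
        fun t ht => hsub hb ht))
      (fun t ht => by
        have hd := hc.hasDerivAt_liftG (hsub hb ht)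
        exact (((hasDerivAt_aF (hbp t ht).2).comp t hd).prodMk
          ((hasDerivAt_bF (hbp t ht).2).comp t hd)).continuousAt.continuousWithinAt)
      (fun t ht => by
        have ht' := Ico_subset_Icc_self ht
        exact (hc.hasDerivWithinAt_chartW (hsub hb ht') (hbp t ht').1).mono_of_mem_nhdsWithin
          (hmem hb ht))
      (fun t ht => by
        have ht' := Ico_subset_Icc_self ht
        have hd := hc.hasDerivAt_liftG (hsub hb ht')
        refine (((hasDerivAt_aF (hbp t ht').2).comp t hd).prodMk
          ((hasDerivAt_bF (hbp t ht').2).comp t hd)).hasDerivWithinAt.congr_deriv ?_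
        ext
        · simp only [Prod.smul_fst, smul_eq_mul]; field_simp
        · simp only [Prod.smul_snd, smul_eq_mul]; field_simp)
      (by
        obtain ⟨e0, e2⟩ := h.chart (Or.inl hz)
        simp only [Prod.mk.injEq]
        exact ⟨(div_eq_iff h1).mpr e0, (div_eq_iff h1).mpr e2⟩)
    filter_upwards [Icc_mem_nhdsGT hb.1] with r hr
    have e := heq hr
    simp only [Prod.mk.injEq] at e
    exact rep_of_chart (hbp r hr).2 ((div_eq_iff (hbp r hr).1).mp e.1)
      ((div_eq_iff (hbp r hr).1).mp e.2)
  · have h2 := h.ne_zero_two (hc.ne_zero s hsI) hz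
    have hev := (((hc.continuousOn_coord 2) s hsI).eventually_ne h2).and
      (hG.eventually (isOpen_compl_hexLattice.mem_nhds hz))
    obtain ⟨b, hb, hbp⟩ := exists_Icc_of_eventually hs hev
    have heq := eqOn_of_ode contDiff_chartZ_field (θ := psiSpeed c)
      (hc.continuousOn_psiSpeed.mono fun t ht => hsub hb ht)
      (f := fun r => (c r 0 / c r 2, c r 1 / c r 2))
      (g := fun r => (xF (liftG c r), wF (liftG c r)))
      (fun t ht => ((hc.hasDerivWithinAt_chartZ (hsub hb ht) (hbp t ht).1).continuousWithinAt.mono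
        fun t ht => hsub hb ht))
      (fun t ht => by
        have hd := hc.hasDerivAt_liftG (hsub hb ht)
        exact (((hasDerivAt_xF (hbp t ht).2).comp t hd).prodMk
          ((hasDerivAt_wF (hbp t ht).2).comp t hd)).continuousAt.continuousWithinAt)
      (fun t ht => by
        have ht' := Ico_subset_Icc_self ht
        exact (hc.hasDerivWithinAt_chartZ (hsub hb ht') (hbp t ht').1).mono_of_mem_nhdsWithin
          (hmem hb ht))
      (fun t ht => by
        have ht' := Ico_subset_Icc_self ht
        have hd := hc.hasDerivAt_liftG (hsub hb ht')
        refine (((hasDerivAt_xF (hbp t ht').2).comp t hd).prodMk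
          ((hasDerivAt_wF (hbp t ht').2).comp t hd)).hasDerivWithinAt.congr_deriv ?_
        ext
        · simp only [Prod.smul_fst, smul_eq_mul]; field_simp
        · simp only [Prod.smul_snd, smul_eq_mul]; field_simp)
      (by
        rcases h with ⟨h, -⟩ | ⟨-, e0, e1⟩
        · exact absurd h hz
        · simp only [Prod.mk.injEq]
          exact ⟨(div_eq_iff h2).mpr e0, (div_eq_iff h2).mpr e1⟩)
    filter_upwards [Icc_mem_nhdsGT hb.1] with r hr
    have e := heq hr
    simp only [Prod.mk.injEq] at e
    exact Or.inr ⟨(hbp r hr).2, (div_eq_iff (hbp r hr).1).mp e.1,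
      (div_eq_iff (hbp r hr).1).mp e.2⟩

/-- A curve starting at the base point is the image of its lift under the uniformisation. -/
theorem rep_integralPsi1 (h0 : c 0 0 = 0) (h2 : c 0 2 = 0) : Rep (integralPsi1 c) (c 1) := by
  have hstart : Rep (liftG c 0) (c 0) := by
    refine Or.inl ⟨?_, h0, h2⟩
    simp [liftG]
  -- Continuous induction on [0, 1]: the set of good parameters contains 0, is closed, and extends
  -- to the right of each of its points below 1.
  have := hc.isClosed_rep.Icc_subset_of_forall_mem_nhdsWithin hstart
    (fun s hs => hc.rep_nhdsGT hs.2 hs.1)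
  rw [← liftG_one]
  exact this (right_mem_Icc.mpr zero_le_one)

end IsConeCurve

end

/-! ### Existence of paths, the Abel-Jacobi map, and its compatibility with the isogeny. -/

section

open scoped PeriodPair
open Filter Topology Set

/-- A lift of the uniformisation to homogeneous coordinates, regular at the origin. -/
def coneLift (z : ℂ) : Fin 3 → ℂ :=
  ![36 / psiConst ^ 2 * (z ^ 3 * hexPair.weierstrassPExcept 0 z + z),
    -108 / psiConst ^ 3 * (z ^ 3 * hexPair.derivWeierstrassPExcept 0 z - 2), z ^ 3]

theorem rep_coneLift {z : ℂ} (hz : z = 0 ∨ z ∉ hexPair.lattice) : Rep z (coneLift z) := by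
  by_cases h0 : z = 0
  · subst h0
    exact Or.inl ⟨hexPair.lattice.zero_mem, by simp [coneLift], by simp [coneLift]⟩
  · refine Or.inr ⟨hz.resolve_left h0, ?_, ?_⟩
    · have := sq_mul_weierstrassP h0
      simp only [coneLift, Matrix.cons_val, xF]
      linear_combination -(36 / psiConst ^ 2 * z) * this
    · have := cube_mul_derivWeierstrassP h0
      simp only [coneLift, Matrix.cons_val, wF]
      linear_combination -(-108 / psiConst ^ 3) * this

theorem coneLift_ne_zero (z : ℂ) : coneLift z ≠ 0 := by
  intro h
  have h2 : z ^ 3 = 0 := congrFun h 2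
  have hz : z = 0 := pow_eq_zero_iff (by norm_num) |>.mp h2
  subst hz
  have h1 := congrFun h 1
  simp [coneLift, psiConst_ne_zero] at h1

theorem contDiffAt_coneLift {z : ℂ} (hz : z = 0 ∨ z ∉ hexPair.lattice) :
    ContDiffAt ℂ 1 coneLift z := by
  have hmem : z ∈ ((hexPair.lattice : Set ℂ) \ {0})ᶜ := by
    rcases hz with rfl | hz
    · simp
    · exact fun h => hz h.1
  have h1 : ContDiffAt ℂ 1 (hexPair.weierstrassPExcept 0) z :=
    (hexPair.analyticOnNhd_weierstrassPExcept 0 z hmem).contDiffAt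
  have h2 : ContDiffAt ℂ 1 (hexPair.derivWeierstrassPExcept 0) z :=
    (hexPair.analyticOnNhd_derivWeierstrassPExcept 0 z hmem).contDiffAt
  rw [contDiffAt_pi]
  intro i
  fin_cases i
  · simp only [coneLift, Fin.zero_eta, Matrix.cons_val]; fun_prop
  · simp only [coneLift, Fin.mk_one, Matrix.cons_val]; fun_prop
  · simp only [coneLift, Fin.reduceFinMk, Matrix.cons_val]; fun_prop

/-- A representative of P with both coordinates at most 1/2 in absolute value is joined to 0 by a
segment containing no period except 0. On it `coneLift`, which is z³(x, w, 1) with the pole at 0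
cleared, is smooth and non-zero. -/
theorem exists_isPath (P : CurveC) : ∃ c, IsPath c P1 P := by
  obtain ⟨z₀, hz₀⟩ := exists_rep P.2
  obtain ⟨a, b, ha, hb, hl⟩ := exists_coord_le z₀
  set z : ℂ := a * zeta + b with hz
  have hzP : Rep z P.1.rep := by
    have := hz₀.add_mem (hexPair.lattice.neg_mem hl)
    rwa [show z₀ + -(z₀ - z) = z by ring] at this
  have hseg : ∀ s ∈ Icc (0 : ℝ) 1, (s : ℂ) * z = 0 ∨ (s : ℂ) * z ∉ hexPair.lattice := by
    intro s hs
    by_contra! hcon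
    have hsz : (s : ℂ) * z = ((s * a : ℝ) : ℂ) * zeta + ((s * b : ℝ) : ℂ) := by
      rw [hz]; push_cast; ring
    obtain ⟨h0, hm⟩ := hcon
    rw [hsz] at h0 hm
    obtain ⟨⟨m, hm⟩, n, hn⟩ := mem_hexPair_lattice_coord.mp hm
    have key : ∀ (k : ℤ) (x : ℝ), |x| ≤ 1 / 2 → (k : ℝ) = s * x → k = 0 := by
      intro k x hx hk
      have h1 : |(k : ℝ)| ≤ 1 / 2 := by
        rw [hk, abs_mul, abs_of_nonneg hs.1]
        nlinarith [abs_nonneg x, hs.2]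
      have h2 : |(k : ℝ)| < 1 := by linarith
      rw [← Int.cast_abs] at h2
      have h3 : |k| < 1 := by exact_mod_cast h2
      exact Int.abs_lt_one_iff.mp h3
    rw [key m a ha hm] at hm
    rw [key n b hb hn] at hn
    apply h0
    rw [← hm, ← hn]
    simp
  refine ⟨fun s => coneLift (s * z), ?_, ?_, ?_, ?_⟩
  · intro s hs
    have h1 : ContDiffAt ℝ 1 coneLift ((s : ℂ) * z) :=
      (contDiffAt_coneLift (hseg s hs)).restrict_scalars ℝ
    have h2 : ContDiffAt ℝ 1 (fun s : ℝ => (s : ℂ) * z) s :=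
      (Complex.ofRealCLM.contDiff.contDiffAt).mul contDiffAt_const
    exact (ContDiffAt.comp s h1 h2).contDiffWithinAt
  · exact fun s hs => ⟨coneLift_ne_zero _, (rep_coneLift (hseg s hs)).onCubic⟩
  · refine ⟨coneLift_ne_zero _, ?_⟩
    refine Rep.mk_eq (z := 0) ?_ ?_ _ vec_inf_ne_zero
    · have := rep_coneLift (hseg 0 (by simp))
      simpa using this
    · exact Or.inl ⟨hexPair.lattice.zero_mem, rfl, rfl⟩
  · refine ⟨coneLift_ne_zero _, ?_⟩
    rw [← Projectivization.mk_rep P.1]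
    refine Rep.mk_eq (z := z) ?_ hzP _ _
    have := rep_coneLift (hseg 1 (by simp))
    simpa using this

theorem IsPath.isConeCurve {c : ℝ → Fin 3 → ℂ} {P Q : CurveC} (hc : IsPath c P Q) :
    IsConeCurve c :=
  ⟨hc.1, fun s hs => (hc.2.1 s hs).1, fun s hs => (hc.2.1 s hs).2⟩

theorem IsPath.rep {c : ℝ → Fin 3 → ℂ} {P : CurveC} (hc : IsPath c P1 P) :
    Rep (integralPsi1 c) P.1.rep := by
  obtain ⟨h0, hP1⟩ := hc.2.2.1
  obtain ⟨h1, hP⟩ := hc.2.2.2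
  obtain ⟨a, ha⟩ := (Projectivization.mk_eq_mk_iff' ℂ _ _ h0 vec_inf_ne_zero).mp hP1
  have hrep : Rep (integralPsi1 c) (c 1) :=
    hc.isConeCurve.rep_integralPsi1 (by simp [← ha]) (by simp [← ha])
  rw [← Projectivization.mk_rep P.1] at hP
  obtain ⟨b, hb⟩ := (Projectivization.mk_eq_mk_iff' ℂ _ _ P.1.rep_nonzero h1).mp hP.symm
  rw [← hb]
  exact hrep.smul b

/-- Eliminates the chosen path: its integral and z both represent P, so they differ by a period. -/
theorem abelJacobi_eq_of_rep {P : CurveC} {z : ℂ} (hz : Rep z P.1.rep) :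
    abelJacobi P = (z : torusE) := by
  have h := exists_isPath P
  rw [abelJacobi, dif_pos h]
  refine QuotientAddGroup.eq.mpr ?_
  rw [← mem_hexPair_lattice_iff_mem_latticeL, neg_add_eq_sub]
  exact h.choose_spec.rep.sub_mem P.1.rep_nonzero hz

theorem abelJacobi_bijective : Function.Bijective abelJacobi := by
  constructor
  · intro P Q h
    obtain ⟨z, hz⟩ := exists_rep P.2
    obtain ⟨w, hw⟩ := exists_rep Q.2
    rw [abelJacobi_eq_of_rep hz, abelJacobi_eq_of_rep hw] at h
    have hl := QuotientAddGroup.eq.mp h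
    rw [← mem_hexPair_lattice_iff_mem_latticeL] at hl
    have hw' := hz.add_mem hl
    rw [add_neg_cancel_left] at hw'
    apply Subtype.ext
    rw [← Projectivization.mk_rep P.1, ← Projectivization.mk_rep Q.1]
    exact hw'.mk_eq hw _ _
  · intro x
    obtain ⟨z, rfl⟩ := QuotientAddGroup.mk_surjective x
    obtain ⟨p, hp, hr⟩ : ∃ p : Fin 3 → ℂ, p ≠ 0 ∧ Rep z p := by
      by_cases hz : z ∈ hexPair.lattice
      · exact ⟨![0, 1, 0], vec_inf_ne_zero, Or.inl ⟨hz, rfl, rfl⟩⟩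
      · refine ⟨![xF z, wF z, 1], fun h => one_ne_zero (congrFun h 2), Or.inr ⟨hz, ?_, ?_⟩⟩ <;>
          simp
    refine ⟨point p hp hr.onCubic, abelJacobi_eq_of_rep ?_⟩
    obtain ⟨a, ha⟩ := Projectivization.exists_smul_eq_mk_rep ℂ p hp
    change Rep z (Projectivization.mk ℂ p hp).rep
    rw [← ha]
    exact hr.smul (a : ℂ)

theorem hasDerivWithinAt_phi {c : ℝ → Fin 3 → ℂ} {v : Fin 3 → ℂ} {S : Set ℝ} {s : ℝ}
    (hc : HasDerivWithinAt c v S s) :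
    HasDerivWithinAt (fun r => phi (c r)) (dphi (c s) v) S s := by
  have d0 := hasDerivWithinAt_pi.mp hc 0
  have d1 := hasDerivWithinAt_pi.mp hc 1
  have d2 := hasDerivWithinAt_pi.mp hc 2
  rw [hasDerivWithinAt_pi]
  intro i
  fin_cases i
  · refine ((d0.const_mul (1 + zeta)).fun_mul
      ((d1.fun_pow 2).fun_add ((d2.fun_pow 2).const_mul 3))).congr_deriv ?_
    simp only [dphi, Fin.zero_eta, Matrix.cons_val, Nat.cast_ofNat, Nat.add_one_sub_one,
      pow_one]
    ring
  · refine (d1.fun_mul ((d1.fun_pow 2).fun_sub ((d2.fun_pow 2).const_mul 9))).congr_deriv ?_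
    simp only [dphi, Fin.mk_one, Matrix.cons_val, Nat.cast_ofNat, Nat.add_one_sub_one,
      pow_one]
    ring
  · refine ((d2.fun_mul ((d1.fun_pow 2).fun_sub (d2.fun_pow 2))).const_mul
      ((1 + zeta) ^ 3)).congr_deriv ?_
    simp only [dphi, Fin.reduceFinMk, Matrix.cons_val, Nat.cast_ofNat, Nat.add_one_sub_one,
      pow_one]

theorem contDiff_phi : ContDiff ℝ 1 phi := by
  rw [contDiff_pi]
  intro i
  fin_cases i
  · simp only [phi, Fin.zero_eta, Matrix.cons_val]; fun_prop
  · simp only [phi, Fin.mk_one, Matrix.cons_val]; fun_prop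
  · simp only [phi, Fin.reduceFinMk, Matrix.cons_val]; fun_prop

theorem IsPath.phi {c : ℝ → Fin 3 → ℂ} {P : CurveC} (hc : IsPath c P1 P) :
    IsPath (fun s => phi (c s)) P1 (phiMap P) := by
  have hne : ∀ s ∈ Icc (0 : ℝ) 1, ZetaCurve.phi (c s) ≠ 0 := fun s hs =>
    phi_ne_zero (hc.2.1 s hs).1 (hc.2.1 s hs).2
  refine ⟨contDiff_phi.comp_contDiffOn hc.1, fun s hs => ⟨hne s hs, (hc.2.1 s hs).2.phi⟩, ?_, ?_⟩
  · obtain ⟨h0, h⟩ := hc.2.2.1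
    refine ⟨hne 0 (by simp), ?_⟩
    rw [← phiMap_val h0 _ h, phiMap_P1]
  · obtain ⟨h1, h⟩ := hc.2.2.2
    refine ⟨hne 1 (by simp), ?_⟩
    rw [← phiMap_val h1 _ h]

theorem integralPsi1_phi {c : ℝ → Fin 3 → ℂ} (hc : IsConeCurve c) :
    integralPsi1 (fun s => phi (c s)) = (1 + zeta) * integralPsi1 c := by
  unfold integralPsi1
  rw [← mul_div_assoc, ← intervalIntegral.integral_const_mul]
  congr 1
  refine intervalIntegral.integral_congr fun s hs => ?_
  rw [uIcc_of_le zero_le_one] at hs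
  have hd := hc.hasDerivWithinAt hs
  simp only
  rw [(hasDerivWithinAt_phi hd).derivWithin (uniqueDiffOn_Icc zero_lt_one s hs)]
  exact psi_phi (hc.ne_zero s hs) (hc.onCubic s hs) (isTangent_of_hasDerivWithinAt hs hd hc.onCubic)

/-- `phi` fixes P₁, so it carries a path from P₁ to P to a path from P₁ to the image of P, whose
integral is 1 + ζ times the original. -/
theorem abelJacobi_phiMap (P : CurveC) :
    abelJacobi (phiMap P) = mulOneAddZeta (abelJacobi P) := by
  obtain ⟨c, hc⟩ := exists_isPath P
  rw [abelJacobi_eq_of_rep hc.rep, abelJacobi_eq_of_rep hc.phi.rep,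
    integralPsi1_phi hc.isConeCurve]
  rfl

end

end

end ZetaCurve

/-! ### The main theorem. -/

theorem mainTheorem4 :
    -- the Abel-Jacobi map is well defined: paths exist, and the integral does not depend on them
    (∀ P : ZetaCurve.CurveC,
      (∃ c, ZetaCurve.IsPath c ZetaCurve.P1 P) ∧
      ∀ c, ZetaCurve.IsPath c ZetaCurve.P1 P →
        ZetaCurve.abelJacobi P = (ZetaCurve.integralPsi1 c : ZetaCurve.torusE)) ∧
    -- it is bijective, and multiplication by `1 + ζ` is given by the formula
    ∃ hj : Function.Bijective ZetaCurve.abelJacobi,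
      Continuous (fun P : ZetaCurve.CurveC => (Equiv.ofBijective ZetaCurve.abelJacobi hj).symm
        (ZetaCurve.mulOneAddZeta (ZetaCurve.abelJacobi P))) ∧
      ∀ P Q : ZetaCurve.CurveC,
        Q = (Equiv.ofBijective ZetaCurve.abelJacobi hj).symm
          (ZetaCurve.mulOneAddZeta (ZetaCurve.abelJacobi P)) →
        (ZetaCurve.IsFinite P → 4 * ZetaCurve.tCoord P - 3 ≠ 0 →
          ZetaCurve.IsFinite Q ∧
          ZetaCurve.tCoord Q = ZetaCurve.tCoord P * (9 - 8 * ZetaCurve.tCoord P) ^ 2 /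
            (4 * ZetaCurve.tCoord P - 3) ^ 3 ∧
          ZetaCurve.uCoord Q = ZetaCurve.ex (1 / 12) * (Real.sqrt 3 : ℂ) * ZetaCurve.uCoord P *
            (9 - 8 * ZetaCurve.tCoord P) / (4 * ZetaCurve.tCoord P - 3) ^ 2) ∧
        (ZetaCurve.IsFinite P → 4 * ZetaCurve.tCoord P - 3 = 0 → ¬ ZetaCurve.IsFinite Q) ∧
        (¬ ZetaCurve.IsFinite P → Q = ZetaCurve.P1) := by
  refine ⟨fun P => ⟨ZetaCurve.exists_isPath P, fun c hc =>
    ZetaCurve.abelJacobi_eq_of_rep hc.rep⟩, ZetaCurve.abelJacobi_bijective, ?_⟩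
  -- Identifies the transported multiplication by 1 + ζ with the explicit map, after which each
  -- claim is a property of `phiMap`.
  have key : ∀ P : ZetaCurve.CurveC,
      (Equiv.ofBijective ZetaCurve.abelJacobi ZetaCurve.abelJacobi_bijective).symm
        (ZetaCurve.mulOneAddZeta (ZetaCurve.abelJacobi P)) = ZetaCurve.phiMap P := fun P => by
    rw [Equiv.symm_apply_eq, Equiv.ofBijective_apply, ZetaCurve.abelJacobi_phiMap]
  refine ⟨?_, fun P Q hQ => ?_⟩
  · simp only [key]
    exact ZetaCurve.continuous_phiMap
  · rw [key] at hQ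
    subst hQ
    exact ⟨ZetaCurve.phiMap_coord P, ZetaCurve.not_isFinite_phiMap P,
      ZetaCurve.phiMap_of_not_isFinite P⟩
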